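/- \textbf{Model.} The network is a finite simple graph $G=(V,E)$ with $n\ge 1$ nodes and maximum degree $\Delta$. Computation proceeds in synchronous rounds. Nodes are anonymous; each node knows its incident edges only through an (arbitrary, adversarial) port numbering, has a private infinite sequence of fair random bits, all bits of all nodes being independent, and initially knows about the network only two numbers $N$ and $D$. In each round a node is awake or asleep. An awake node may send one message (a bit string) through each of its ports, receives the messages sent to it in this round by its awake neighbours, performs an arbitrary local computation, and then either terminates with an output bit or fixes the number of rounds for which it sleeps before it is awake again. A sleeping node sends and receives nothing and does not compute; messages sent to it are lost. All nodes are awake in the first round. The awake complexity $A_v$ of a node $v$ is the number of rounds in which $v$ is awake until it terminates, and the (node-averaged) awake complexity of an execution is $\frac1n\sum_{v\in V}A_v$. The round complexity is the number of rounds until all nodes have terminated. \textbf{Statement.} For every $c\in\mathbb{N}$ there are constants $\kappa,K>0$ such that for every $0<\varepsilon\le 1/1000$ there are constants $L,B>0$ and a randomized algorithm in this model (a family indexed by $N,D$) with the following property. Let $G$ be any $n$-node graph, with any port numbering, whose minimum vertex cover $C^*$ satisfies $|C^*|\ge\kappa(\log n)^{18}$, and let the nodes be given integers with $n\le N\le n^c$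 and $\Delta\le D\le\max(\Delta,2)^c$. Then: \begin{itemize} \item for every outcome of the random bits, all nodes terminate within $L\log\max(\Delta,2)$ rounds, every message sent has at most $B\log n$ bits, and the set $C$ of nodes with output $1$ is a vertex cover of $G$; \item with probability at least $1-n^{-5}$, both $|C|\le(2+100\varepsilon)\,|C^*|$ and $\frac1n\sum_{v\in V}A_v\le K\varepsilon^{-3}$ hold. \end{itemize} -/

import Mathlib

open MeasureTheory
open scoped ENNReal

/-- An anonymous randomized algorithm for the synchronous message-passing sleeping model, from the
viewpoint of one node with `d` ports (incident edges), numbered by `Fin d`.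

* `State d` is the set of local memory states of a node of degree `d`.
* `init d r` is the initial state of a node with private sequence `r` of random bits.
* `send s p` is the message (a bit string, or `none` for silence) that a node which starts an awake
  round in state `s` sends through its port `p`.
* `step s inbox` is computed at the end of an awake round that was started in state `s` and in which
  `inbox p` was received through port `p`. It gives the new state and an alarm: `some k` means
  "sleep for `k` rounds and then wake up" (so `some 0` means "be awake in the next round as well"),
  and `none` means "terminate".
* `output s` is the output of a node that has terminated in state `s`. -/
structure SleepingAlgorithm where
  State : ℕ → Type
  init : (d : ℕ) → (ℕ → Bool) → State d
  send : {d : ℕ} → State d → Fin d → Option (List Bool)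
  step : {d : ℕ} → State d → (Fin d → Option (List Bool)) → State d × Option ℕ
  output : {d : ℕ} → State d → Bool

/-- The status of a node of degree `d` at the beginning of a round: its memory and its alarm
(`some 0`: awake in this round; `some (k + 1)`: asleep in this round, `k` further rounds of sleep
remain after it; `none`: terminated). -/
structure NodeStatus (A : SleepingAlgorithm) (d : ℕ) where
  state : A.State d
  alarm : Option ℕ

/-- A port numbering: every node numbers its incident edges. -/
abbrev PortNumbering {V : Type*} [Fintype V] (G : SimpleGraph V) [DecidableRel G.Adj] : Type _ :=
  (v : V) → Fin (G.degree v) ≃ G.neighborSet v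

/-- All coin flips of all nodes: node `v` owns the bits `ω (v, 0), ω (v, 1), …`. -/
abbrev Coins (V : Type*) : Type _ := V × ℕ → Bool

/-- All the bits of all the nodes are independent fair coin flips. -/
noncomputable def coinMeasure (V : Type*) : Measure (Coins V) :=
  Measure.infinitePi fun _ : V × ℕ => (PMF.uniformOfFintype Bool).toMeasure

namespace SleepingAlgorithm

section Execution

variable {V : Type*} [Fintype V] {G : SimpleGraph V} [DecidableRel G.Adj]

/-- What node `v` receives through port `p` in a round at whose beginning the nodes have the
statuses `σ`: the message sent by the neighbour `u` behind `p` through the port of `u` that leads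
to `v`, provided that `u` is awake. -/
def inbox (A : SleepingAlgorithm) (P : PortNumbering G) (σ : (v : V) → NodeStatus A (G.degree v))
    (v : V) (p : Fin (G.degree v)) : Option (List Bool) :=
  let u := P v p
  if (σ u).alarm = some 0 then
    A.send (σ u).state ((P u).symm ⟨v, SimpleGraph.Adj.symm u.2⟩)
  else none

/-- One synchronous round. Awake nodes communicate and compute; sleeping nodes only count down
(whatever was sent to them is lost); terminated nodes do nothing. -/
def round (A : SleepingAlgorithm) (P : PortNumbering G) (σ : (v : V) → NodeStatus A (G.degree v))
    (v : V) : NodeStatus A (G.degree v) :=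
  match (σ v).alarm with
  | none => σ v
  | some (k + 1) => ⟨(σ v).state, some k⟩
  | some 0 =>
    let r := A.step (σ v).state (A.inbox P σ v)
    ⟨r.1, r.2⟩

/-- The status of the nodes at the beginning of round `t` (rounds are numbered `0, 1, 2, …`).
All nodes are awake in the first round. -/
def run (A : SleepingAlgorithm) (P : PortNumbering G) (ω : Coins V) :
    ℕ → (v : V) → NodeStatus A (G.degree v)
  | 0 => fun v => ⟨A.init (G.degree v) fun k => ω (v, k), some 0⟩
  | t + 1 => A.round P (A.run P ω t)

/-- Node `v` is awake in round `t`. -/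
def IsAwake (A : SleepingAlgorithm) (P : PortNumbering G) (ω : Coins V) (t : ℕ) (v : V) : Prop :=
  (A.run P ω t v).alarm = some 0

/-- Node `v` has terminated within the first `t` rounds. -/
def HasHalted (A : SleepingAlgorithm) (P : PortNumbering G) (ω : Coins V) (t : ℕ) (v : V) : Prop :=
  (A.run P ω t v).alarm = none

/-- The awake complexity of `v`: the number of rounds in which `v` is awake. -/
noncomputable def awakeComplexity (A : SleepingAlgorithm) (P : PortNumbering G) (ω : Coins V)
    (v : V) : ℕ∞ :=
  {t : ℕ | A.IsAwake P ω t v}.encard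

/-- The node-averaged awake complexity: the mean over all nodes of their awake complexities. -/
noncomputable def nodeAveragedAwakeComplexity (A : SleepingAlgorithm) (P : PortNumbering G)
    (ω : Coins V) : ℝ≥0∞ :=
  (∑ v : V, (A.awakeComplexity P ω v : ℝ≥0∞)) / (Fintype.card V : ℝ≥0∞)

/-- The set of nodes that terminate with output `true`. -/
def outputSet (A : SleepingAlgorithm) (P : PortNumbering G) (ω : Coins V) : Set V :=
  {v | ∃ t, A.HasHalted P ω t v ∧ A.output (A.run P ω t v).state = true}

/-- Every message that is ever sent has at most `b` bits. -/
def MessageBitsLE (A : SleepingAlgorithm) (P : PortNumbering G) (ω : Coins V) (b : ℝ) : Prop :=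
  ∀ (t : ℕ) (v : V) (p : Fin (G.degree v)) (m : List Bool), A.IsAwake P ω t v →
    A.send (A.run P ω t v).state p = some m → (m.length : ℝ) ≤ b

end Execution

end SleepingAlgorithm

/-! ### Averaging over independent bits, and the bounded differences inequality -/

section Averaging

variable {ι : Type*} [DecidableEq ι]

/-- Average a function of bits over coordinate `i`, which is `true` with probability `p i`. -/
def bitAvg (p : ι → ℝ) (i : ι) (F : (ι → Bool) → ℝ) (β : ι → Bool) : ℝ :=
  p i * F (Function.update β i true) + (1 - p i) * F (Function.update β i false)

/-- Average a function of bits over all the coordinates in a list. -/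
def listAvg (p : ι → ℝ) (l : List ι) (F : (ι → Bool) → ℝ) : (ι → Bool) → ℝ :=
  l.foldr (bitAvg p) F

variable {p : ι → ℝ}

@[simp] theorem listAvg_nil (F : (ι → Bool) → ℝ) : listAvg p [] F = F := rfl

@[simp] theorem listAvg_cons (i : ι) (l : List ι) (F : (ι → Bool) → ℝ) :
    listAvg p (i :: l) F = bitAvg p i (listAvg p l F) := rfl

theorem bitAvg_mono (hp : ∀ i, p i ∈ Set.Icc (0 : ℝ) 1) (i : ι) {F H : (ι → Bool) → ℝ}
    (h : ∀ β, F β ≤ H β) (β : ι → Bool) : bitAvg p i F β ≤ bitAvg p i H β := by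
  have h0 := (hp i).1
  have h1 := (hp i).2
  exact add_le_add (mul_le_mul_of_nonneg_left (h _) h0)
    (mul_le_mul_of_nonneg_left (h _) (by linarith))

theorem listAvg_mono (hp : ∀ i, p i ∈ Set.Icc (0 : ℝ) 1) (l : List ι) {F H : (ι → Bool) → ℝ}
    (h : ∀ β, F β ≤ H β) (β : ι → Bool) : listAvg p l F β ≤ listAvg p l H β := by
  induction l generalizing β with
  | nil => exact h β
  | cons i l ih => exact bitAvg_mono hp i ih β

theorem listAvg_const_mul (l : List ι) (a : ℝ) (F : (ι → Bool) → ℝ) :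
    listAvg p l (fun β => a * F β) = fun β => a * listAvg p l F β := by
  induction l with
  | nil => rfl
  | cons i l ih => ext β; simp only [listAvg_cons, ih, bitAvg]; ring

theorem listAvg_add (l : List ι) (F H : (ι → Bool) → ℝ) :
    listAvg p l (fun β => F β + H β) = fun β => listAvg p l F β + listAvg p l H β := by
  induction l with
  | nil => rfl
  | cons i l ih => ext β; simp only [listAvg_cons, ih, bitAvg]; ring

theorem listAvg_const (l : List ι) (a : ℝ) : listAvg p l (fun _ => a) = fun _ => a := by
  induction l with
  | nil => rfl
  | cons i l ih => ext β; simp only [listAvg_cons, ih, bitAvg]; ring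

theorem listAvg_sum {κ : Type*} (l : List ι) (s : Finset κ) (F : κ → (ι → Bool) → ℝ) :
    listAvg p l (fun β => ∑ k ∈ s, F k β) = fun β => ∑ k ∈ s, listAvg p l (F k) β := by
  classical
  induction s using Finset.induction_on with
  | empty => simpa using listAvg_const (p := p) l 0
  | insert a s ha ih =>
    simp only [Finset.sum_insert ha, listAvg_add, ih]

theorem listAvg_coord_of_notMem {l : List ι} {i : ι} (hi : i ∉ l) :
    listAvg p l (fun β => if β i then (1 : ℝ) else 0) = fun β => if β i then 1 else 0 := by
  induction l with
  | nil => rfl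
  | cons j l ih =>
    have hij : i ≠ j := fun h => hi (by simp [h])
    ext β
    simp only [listAvg_cons, ih (fun h => hi (List.mem_cons_of_mem _ h)), bitAvg,
      Function.update_of_ne hij]
    ring

theorem listAvg_coord {l : List ι} (hl : l.Nodup) {i : ι} (hi : i ∈ l) (β : ι → Bool) :
    listAvg p l (fun β => if β i then (1 : ℝ) else 0) β = p i := by
  induction l generalizing β with
  | nil => simp at hi
  | cons j l ih =>
    rw [List.nodup_cons] at hl
    by_cases hij : i = j
    · subst hij
      simp [listAvg_coord_of_notMem hl.1, bitAvg]
    · have := ih hl.2 ((List.mem_cons.1 hi).resolve_left hij)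
      simp only [listAvg_cons, bitAvg, this]
      ring

/-- Changing coordinate `i` changes the value of `F` by at most `c`. -/
def BoundedDiff (F : (ι → Bool) → ℝ) (i : ι) (c : ℝ) : Prop :=
  ∀ β, |F (Function.update β i true) - F (Function.update β i false)| ≤ c

theorem BoundedDiff.bitAvg (hp : ∀ i, p i ∈ Set.Icc (0 : ℝ) 1) {F : (ι → Bool) → ℝ} {i : ι}
    {c : ℝ} (h : BoundedDiff F i c) (j : ι) : BoundedDiff (bitAvg p j F) i c := by
  intro β
  have hc : 0 ≤ c := (abs_nonneg _).trans (h β)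
  by_cases hij : i = j
  · subst hij
    simpa [_root_.bitAvg] using hc
  · have h0 := (hp j).1
    have h1 := (hp j).2
    have e1 := h (Function.update β j true)
    have e2 := h (Function.update β j false)
    simp only [_root_.bitAvg, Function.update_comm hij]
    rw [abs_le] at e1 e2 ⊢
    constructor <;> nlinarith

theorem BoundedDiff.listAvg (hp : ∀ i, p i ∈ Set.Icc (0 : ℝ) 1) {F : (ι → Bool) → ℝ} {i : ι}
    {c : ℝ} (h : BoundedDiff F i c) (l : List ι) : BoundedDiff (listAvg p l F) i c := by
  induction l with
  | nil => exact h
  | cons j l ih => exact ih.bitAvg hp j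

theorem Real.exp_le_add_exp_sq (x : ℝ) : Real.exp x ≤ x + Real.exp (x ^ 2) := by
  have h1 : x ^ 2 + 1 ≤ Real.exp (x ^ 2) := Real.add_one_le_exp _
  rcases le_or_gt |x| 1 with h | h
  · have := abs_le.1 (Real.abs_exp_sub_one_sub_id_le h)
    linarith [this.2]
  · rcases lt_abs.1 h with h | h
    · have : Real.exp x ≤ Real.exp (x ^ 2) := Real.exp_le_exp.2 (by nlinarith)
      linarith
    · have : Real.exp x ≤ 1 := Real.exp_le_one_iff.2 (by linarith)
      nlinarith

theorem two_point_exp_le {q : ℝ} (hq : q ∈ Set.Icc (0 : ℝ) 1) (a b : ℝ) :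
    q * Real.exp a + (1 - q) * Real.exp b
      ≤ Real.exp (q * a + (1 - q) * b + (a - b) ^ 2) := by
  obtain ⟨h0, h1⟩ := hq
  set m := q * a + (1 - q) * b with hm
  have ha : Real.exp (a - m) ≤ (a - m) + Real.exp ((a - b) ^ 2) := by
    refine (Real.exp_le_add_exp_sq _).trans (add_le_add le_rfl (Real.exp_le_exp.2 ?_))
    have : a - m = (1 - q) * (a - b) := by rw [hm]; ring
    rw [this, mul_pow]
    exact mul_le_of_le_one_left (sq_nonneg _) (pow_le_one₀ (by linarith) (by linarith))
  have hb : Real.exp (b - m) ≤ (b - m) + Real.exp ((a - b) ^ 2) := by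
    refine (Real.exp_le_add_exp_sq _).trans (add_le_add le_rfl (Real.exp_le_exp.2 ?_))
    have : b - m = (-q) * (a - b) := by rw [hm]; ring
    rw [this, mul_pow]
    exact mul_le_of_le_one_left (sq_nonneg _) (by rw [neg_sq]; exact pow_le_one₀ h0 h1)
  have key : q * Real.exp (a - m) + (1 - q) * Real.exp (b - m) ≤ Real.exp ((a - b) ^ 2) := by
    have e1 := mul_le_mul_of_nonneg_left ha h0
    have e2 := mul_le_mul_of_nonneg_left hb (sub_nonneg.2 h1)
    have e3 : q * (a - m) + (1 - q) * (b - m) = 0 := by rw [hm]; ring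
    nlinarith
  calc q * Real.exp a + (1 - q) * Real.exp b
      = Real.exp m * (q * Real.exp (a - m) + (1 - q) * Real.exp (b - m)) := by
        rw [mul_add, mul_left_comm, mul_left_comm (Real.exp m), ← Real.exp_add, ← Real.exp_add]
        simp
    _ ≤ Real.exp m * Real.exp ((a - b) ^ 2) :=
        mul_le_mul_of_nonneg_left key (Real.exp_pos _).le
    _ = _ := (Real.exp_add _ _).symm

theorem listAvg_exp_le (hp : ∀ i, p i ∈ Set.Icc (0 : ℝ) 1) {F : (ι → Bool) → ℝ} {c : ι → ℝ}
    (l : List ι) (hF : ∀ i ∈ l, BoundedDiff F i (c i)) (β : ι → Bool) :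
    listAvg p l (fun β => Real.exp (F β)) β
      ≤ Real.exp (listAvg p l F β + (l.map fun i => c i ^ 2).sum) := by
  induction l generalizing β with
  | nil => simp
  | cons i l ih =>
    set S := (l.map fun i => c i ^ 2).sum
    have h1 : ∀ β, listAvg p l (fun β => Real.exp (F β)) β
        ≤ Real.exp (listAvg p l F β) * Real.exp S := fun β => by
      rw [← Real.exp_add]
      exact ih (fun i hi => hF i (List.mem_cons_of_mem _ hi)) β
    have hd := (hF i List.mem_cons_self).listAvg hp l β
    have h2 := two_point_exp_le (hp i) (listAvg p l F (Function.update β i true))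
      (listAvg p l F (Function.update β i false))
    have h3 : (listAvg p l F (Function.update β i true)
      - listAvg p l F (Function.update β i false)) ^ 2 ≤ c i ^ 2 := by
      rw [← sq_abs]
      exact pow_le_pow_left₀ (abs_nonneg _) hd 2
    calc listAvg p (i :: l) (fun β => Real.exp (F β)) β
        ≤ bitAvg p i (fun β => Real.exp (listAvg p l F β) * Real.exp S) β :=
          bitAvg_mono hp i h1 β
      _ = (p i * Real.exp (listAvg p l F (Function.update β i true))
            + (1 - p i) * Real.exp (listAvg p l F (Function.update β i false)))
            * Real.exp S := by simp only [bitAvg]; ring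
      _ ≤ Real.exp (bitAvg p i (listAvg p l F) β + c i ^ 2) * Real.exp S := by
          refine mul_le_mul_of_nonneg_right (h2.trans (Real.exp_le_exp.2 ?_)) (Real.exp_pos _).le
          simp only [bitAvg]
          linarith
      _ = _ := by
          rw [← Real.exp_add, listAvg_cons, List.map_cons, List.sum_cons, add_assoc]

/-- The bounded differences inequality. -/
theorem listAvg_upper_tail (hp : ∀ i, p i ∈ Set.Icc (0 : ℝ) 1) {F : (ι → Bool) → ℝ} {c : ι → ℝ}
    (l : List ι) (hF : ∀ i ∈ l, BoundedDiff F i (c i)) {S t : ℝ} (hS : 0 < S) (ht : 0 ≤ t)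
    (hcS : (l.map fun i => c i ^ 2).sum ≤ S) (β₀ : ι → Bool) {E : (ι → Bool) → ℝ}
    (hE : ∀ β, E β ≤ 1) (hE' : ∀ β, F β < listAvg p l F β₀ + t → E β ≤ 0) :
    listAvg p l E β₀ ≤ Real.exp (-(t ^ 2 / (4 * S))) := by
  set lam := t / (2 * S) with hlam
  have hlam0 : 0 ≤ lam := by positivity
  set m := listAvg p l F β₀
  have h1 : ∀ β, E β ≤ Real.exp (-(lam * (m + t))) * Real.exp (lam * F β) := fun β => by
    rw [← Real.exp_add]
    by_cases h : F β < m + t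
    · exact (hE' β h).trans (Real.exp_pos _).le
    · refine (hE β).trans (Real.one_le_exp ?_)
      nlinarith
  have h2 : ∀ i ∈ l, BoundedDiff (fun β => lam * F β) i (lam * c i) := fun i hi β => by
    rw [← mul_sub, abs_mul, abs_of_nonneg hlam0]
    exact mul_le_mul_of_nonneg_left (hF i hi β) hlam0
  have h3 := listAvg_exp_le hp l h2 β₀
  refine (listAvg_mono hp l h1 β₀).trans ?_
  rw [listAvg_const_mul]
  refine (mul_le_mul_of_nonneg_left h3 (Real.exp_pos _).le).trans ?_
  rw [← Real.exp_add, listAvg_const_mul, Real.exp_le_exp]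
  have h4 : (l.map fun i => (lam * c i) ^ 2).sum ≤ lam ^ 2 * S := by
    simp only [mul_pow, List.sum_map_mul_left]
    exact mul_le_mul_of_nonneg_left hcS (sq_nonneg _)
  have h5 : lam ^ 2 * S - lam * t = -(t ^ 2 / (4 * S)) := by
    rw [hlam]; field_simp; ring
  change -(lam * (m + t)) + (lam * m + _) ≤ _
  linarith

end Averaging

section Slices

variable {V : Type*}

/-- Replace the bits of step `s` by `b`. -/
def setSlice (β : ℕ × V → Bool) (s : ℕ) (b : V → Bool) : ℕ × V → Bool :=
  fun i => if i.1 = s then b i.2 else β i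

theorem setSlice_of_ne {β : ℕ × V → Bool} {s k : ℕ} (h : k ≠ s) (b : V → Bool) (v : V) :
    setSlice β s b (k, v) = β (k, v) := if_neg h

theorem setSlice_self {β : ℕ × V → Bool} {s : ℕ} (b : V → Bool) :
    (fun v => setSlice β s b (s, v)) = b := funext fun _ => if_pos rfl

theorem listAvg_slice [DecidableEq V] (p : ℕ × V → ℝ) (s : ℕ) (l : List V) (F : (ℕ × V → Bool) → ℝ)
    (β : ℕ × V → Bool) :
    listAvg p (l.map fun v => (s, v)) F β
      = listAvg (fun v => p (s, v)) l (fun b => F (setSlice β s b)) fun v => β (s, v) := by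
  induction l generalizing β with
  | nil =>
    simp only [List.map_nil, listAvg_nil]
    congr 1
    ext ⟨k, v⟩
    by_cases h : k = s <;> simp [setSlice, h]
  | cons v l ih =>
    have h1 : ∀ x b, setSlice (Function.update β (s, v) x) s b = setSlice β s b := by
      intro x b
      ext ⟨k, w⟩
      by_cases h : k = s
      · simp [setSlice, h]
      · simp [setSlice, h]
    have h2 : ∀ x, (fun w => Function.update β (s, v) x (s, w))
        = Function.update (fun w => β (s, w)) v x := by
      intro x
      ext w
      by_cases h : w = v <;> simp [h]
    simp only [List.map_cons, listAvg_cons, bitAvg, ih, h1, h2]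

end Slices

/-! ### Biased bits made from fair coins -/

section Bits

/-- The bit of step `s`: the conjunction of `j s` private coins reserved for that step. -/
def sampleBit (j : ℕ → ℕ) (r : ℕ → Bool) (s : ℕ) : Bool :=
  decide (∀ i < j s, r (Nat.pair s i) = true)

/-- The bits of all nodes. -/
def sampleBits {V : Type*} (j : ℕ → ℕ) (ω : Coins V) : ℕ × V → Bool :=
  fun i => sampleBit j (fun k => ω (i.2, k)) i.1

variable {V : Type*}

instance : IsProbabilityMeasure (coinMeasure V) := by
  unfold coinMeasure; infer_instance

/-- Flip one coin. -/
def flipCoin [DecidableEq V] (k : V × ℕ) (ω : Coins V) : Coins V :=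
  fun i => if i = k then !ω i else ω i

theorem measurePreserving_flipCoin [DecidableEq V] (k : V × ℕ) :
    MeasurePreserving (flipCoin k) (coinMeasure V) (coinMeasure V) := by
  have hm : ∀ i : V × ℕ, Measurable (fun b : Bool => if i = k then !b else b) :=
    fun i => Measurable.of_discrete
  have hflip : (flipCoin k : Coins V → Coins V) = fun ω i => (if i = k then !(ω i) else ω i) := rfl
  have hmeas : Measurable (flipCoin k : Coins V → Coins V) := by
    rw [hflip]
    exact measurable_pi_lambda _ fun i => (hm i).comp (measurable_pi_apply i)
  refine ⟨hmeas, ?_⟩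
  unfold coinMeasure
  rw [hflip]
  have := Measure.infinitePi_map_pi (X := fun _ : V × ℕ => Bool) (Y := fun _ => Bool)
    (μ := fun _ : V × ℕ => (PMF.uniformOfFintype Bool).toMeasure) hm
  rw [this]
  congr 1
  ext i : 1
  by_cases h : i = k
  · simp only [h, if_true]
    ext s hs
    rw [Measure.map_apply Measurable.of_discrete hs, PMF.toMeasure_apply_fintype,
      PMF.toMeasure_apply_fintype]
    simp only [Set.indicator, PMF.uniformOfFintype_apply, Fintype.univ_bool, Finset.mem_singleton,
      Bool.true_eq_false, not_false_eq_true, Finset.sum_insert, Finset.sum_singleton]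
    exact add_comm _ _
  · simp [h]

theorem integral_coin_cond [DecidableEq V] (k : V × ℕ) {A B : Coins V → ℝ}
    (hA : Integrable A (coinMeasure V)) (hB : Integrable B (coinMeasure V))
    (hA' : ∀ ω, A (flipCoin k ω) = A ω) (hB' : ∀ ω, B (flipCoin k ω) = B ω) :
    Integrable (fun ω => if ω k = true then A ω else B ω) (coinMeasure V) ∧
    ∫ ω, (if ω k = true then A ω else B ω) ∂coinMeasure V
      = ∫ ω, (A ω + B ω) / 2 ∂coinMeasure V := by
  have hms : MeasurableSet {ω : Coins V | ω k = true} :=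
    measurableSet_eq_fun (measurable_pi_apply k) measurable_const
  have hint : Integrable (fun ω => if ω k = true then A ω else B ω) (coinMeasure V) := by
    have := Integrable.piecewise hms hA.integrableOn hB.integrableOn
    exact this
  refine ⟨hint, ?_⟩
  have h1 : ∫ ω, (if (flipCoin k ω) k = true then A (flipCoin k ω) else B (flipCoin k ω))
      ∂coinMeasure V = ∫ ω, (if ω k = true then A ω else B ω) ∂coinMeasure V :=
    (integral_map (measurePreserving_flipCoin k).aemeasurable
      (f := fun ω => if ω k = true then A ω else B ω)
      (by rw [(measurePreserving_flipCoin k).map_eq]; exact hint.1)).symm.trans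
      (by rw [(measurePreserving_flipCoin k).map_eq])
  have hint' : Integrable (fun ω => if (flipCoin k ω) k = true then A (flipCoin k ω)
      else B (flipCoin k ω)) (coinMeasure V) := (measurePreserving_flipCoin k).integrable_comp_of_integrable hint
  have h2 : ∫ ω, (if ω k = true then A ω else B ω) ∂coinMeasure V
      + ∫ ω, (if (flipCoin k ω) k = true then A (flipCoin k ω) else B (flipCoin k ω))
        ∂coinMeasure V = ∫ ω, (A ω + B ω) ∂coinMeasure V := by
    rw [← integral_add hint hint']
    congr 1
    ext ω
    rw [hA', hB']
    cases h : ω k <;> simp [flipCoin, h, add_comm]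
  rw [integral_div, ← h2, h1]
  ring

theorem integral_block_cond [DecidableEq V] (k : ℕ → V × ℕ) (hk : Function.Injective k) (n : ℕ)
    {A B : Coins V → ℝ}
    (hA : Integrable A (coinMeasure V)) (hB : Integrable B (coinMeasure V))
    (hA' : ∀ i < n, ∀ ω, A (flipCoin (k i) ω) = A ω)
    (hB' : ∀ i < n, ∀ ω, B (flipCoin (k i) ω) = B ω) :
    Integrable (fun ω => if ∀ i < n, ω (k i) = true then A ω else B ω) (coinMeasure V) ∧
    ∫ ω, (if ∀ i < n, ω (k i) = true then A ω else B ω) ∂coinMeasure V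
      = ∫ ω, ((1 / 2) ^ n * A ω + (1 - (1 / 2) ^ n) * B ω) ∂coinMeasure V := by
  induction n generalizing A with
  | zero => simpa using hA
  | succ n ih =>
    obtain ⟨i1, e1⟩ := integral_coin_cond (k n) hA hB (hA' n n.lt_succ_self) (hB' n n.lt_succ_self)
    have hflip : ∀ i < n, ∀ ω, (if (flipCoin (k i) ω) (k n) = true then A (flipCoin (k i) ω)
        else B (flipCoin (k i) ω)) = if ω (k n) = true then A ω else B ω := fun i hi ω => by
      have : k n ≠ k i := fun h => hi.ne' (hk h)
      rw [hA' i (by omega), hB' i (by omega)]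
      simp [flipCoin, this]
    obtain ⟨i2, e2⟩ := ih i1 hflip fun i hi => hB' i (by omega)
    have hfun : (fun ω => if ∀ i < n + 1, ω (k i) = true then A ω else B ω)
        = fun ω => if ∀ i < n, ω (k i) = true then (if ω (k n) = true then A ω else B ω)
          else B ω := by
      ext ω
      by_cases h1 : ∀ i < n, ω (k i) = true
      · by_cases h2 : ω (k n) = true
        · rw [if_pos h1, if_pos h2, if_pos fun i hi => ?_]
          rcases Nat.lt_succ_iff_lt_or_eq.1 hi with h | rfl
          exacts [h1 i h, h2]
        · rw [if_pos h1, if_neg h2, if_neg fun h => h2 (h n n.lt_succ_self)]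
      · rw [if_neg h1, if_neg fun h => h1 fun i hi => h i (by omega)]
    refine ⟨hfun ▸ i2, ?_⟩
    rw [hfun, e2, integral_add (i1.const_mul _) (hB.const_mul _), integral_const_mul, e1,
      ← integral_const_mul]
    refine (integral_add (((hA.add hB).div_const 2).const_mul _) (hB.const_mul _)).symm.trans ?_
    congr 1
    ext ω
    rw [pow_succ, Pi.add_apply]
    ring

theorem measurable_comp_sampleBits [Fintype V] {j : ℕ → ℕ} {R : ℕ} (hj : ∀ s, R ≤ s → j s = 0)
    (F : (ℕ × V → Bool) → ℝ) :
    Measurable (fun ω : Coins V => F (sampleBits j ω)) ∧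
      Integrable (fun ω : Coins V => F (sampleBits j ω)) (coinMeasure V) := by
  let e : (Fin R × V → Bool) → (ℕ × V → Bool) := fun b i =>
    if h : i.1 < R then b (⟨i.1, h⟩, i.2) else true
  let fb : Coins V → (Fin R × V → Bool) := fun ω i => sampleBits j ω (i.1, i.2)
  have hfb : Measurable fb := by
    refine measurable_pi_lambda _ fun i => ?_
    have : MeasurableSet {ω : Coins V | ∀ l < j i.1, ω (i.2, Nat.pair i.1 l) = true} := by
      rw [show {ω : Coins V | ∀ l < j i.1, ω (i.2, Nat.pair i.1 l) = true}
        = ⋂ l, ⋂ _ : l < j i.1, {ω | ω (i.2, Nat.pair i.1 l) = true} by ext; simp]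
      exact MeasurableSet.iInter fun l => MeasurableSet.iInter fun _ =>
        measurableSet_eq_fun (measurable_pi_apply _) measurable_const
    refine measurable_to_bool ?_
    convert this using 1
    ext ω
    simp [fb, sampleBits, sampleBit]
  have he : (fun ω : Coins V => F (sampleBits j ω)) = (F ∘ e) ∘ fb := by
    ext ω
    refine congrArg F ?_
    ext ⟨s, v⟩
    by_cases h : s < R
    · simp [e, fb, h]
    · simp [e, h, sampleBits, sampleBit, hj s (by omega)]
  rw [he]
  exact ⟨Measurable.of_discrete.comp hfb, Integrable.comp_measurable Integrable.of_finite hfb⟩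

/-- The probability that a bit of step `s` is `true`. -/
noncomputable def bitProb (j : ℕ → ℕ) (i : ℕ × V) : ℝ := (1 / 2) ^ j i.1

theorem bitProb_mem (j : ℕ → ℕ) (i : ℕ × V) : bitProb j i ∈ Set.Icc (0 : ℝ) 1 :=
  ⟨by unfold bitProb; positivity, pow_le_one₀ (by norm_num) (by norm_num)⟩

theorem integral_bitAvg [Fintype V] [DecidableEq V] {j : ℕ → ℕ} {R : ℕ}
    (hj : ∀ s, R ≤ s → j s = 0) (i : ℕ × V) (F : (ℕ × V → Bool) → ℝ) :
    ∫ ω : Coins V, F (sampleBits j ω) ∂coinMeasure V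
      = ∫ ω, bitAvg (bitProb j) i F (sampleBits j ω) ∂coinMeasure V := by
  obtain ⟨s, v⟩ := i
  let k : ℕ → V × ℕ := fun l => (v, Nat.pair s l)
  have hk : Function.Injective k := fun a b h => by
    have := (Prod.mk.inj h).2
    exact (Nat.pair_eq_pair.1 this).2
  have hinv : ∀ x l (ω : Coins V), Function.update (sampleBits j (flipCoin (k l) ω)) (s, v) x
      = Function.update (sampleBits j ω) (s, v) x := by
    intro x l ω
    ext ⟨t, w⟩
    by_cases h : (t, w) = (s, v)
    · rw [h]; simp
    · rw [Function.update_of_ne h, Function.update_of_ne h]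
      have hne : ∀ l', (w, Nat.pair t l') ≠ k l := by
        intro l' h'
        obtain ⟨h1, h2⟩ := Prod.mk.inj h'
        exact h (by rw [h1, (Nat.pair_eq_pair.1 h2).1])
      simp [sampleBits, sampleBit, flipCoin, hne]
  have hmain := (integral_block_cond k hk (j s)
    (measurable_comp_sampleBits hj fun β => F (Function.update β (s, v) true)).2
    (measurable_comp_sampleBits hj fun β => F (Function.update β (s, v) false)).2
    (fun l _ ω => by rw [hinv]) (fun l _ ω => by rw [hinv])).2
  refine Eq.trans ?_ hmain
  congr 1
  ext ω
  have hbit : sampleBits j ω (s, v) = decide (∀ i < j s, ω (k i) = true) := rfl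
  split_ifs with h
  · rw [← hbit.trans (decide_eq_true h), Function.update_eq_self]
  · rw [← hbit.trans (decide_eq_false h), Function.update_eq_self]

theorem integral_listAvg [Fintype V] [DecidableEq V] {j : ℕ → ℕ} {R : ℕ}
    (hj : ∀ s, R ≤ s → j s = 0) (l : List (ℕ × V)) (F : (ℕ × V → Bool) → ℝ) :
    ∫ ω : Coins V, F (sampleBits j ω) ∂coinMeasure V
      = ∫ ω, listAvg (bitProb j) l F (sampleBits j ω) ∂coinMeasure V := by
  induction l with
  | nil => rfl
  | cons i l ih => rw [ih, integral_bitAvg hj i, listAvg_cons]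

open Classical in
/-- An event that has small probability conditionally on the bits outside a list has small
probability. -/
theorem coinMeasure_le_of_listAvg_le [Fintype V] {j : ℕ → ℕ} {R : ℕ}
    (hj : ∀ s, R ≤ s → j s = 0) (l : List (ℕ × V)) (E : (ℕ × V → Bool) → Prop) {δ : ℝ}
    (h : ∀ β, listAvg (bitProb j) l (fun β => if E β then 1 else 0) β ≤ δ) :
    coinMeasure V {ω | E (sampleBits j ω)} ≤ ENNReal.ofReal δ := by
  obtain ⟨hmeas, hint⟩ :=
    measurable_comp_sampleBits (V := V) hj fun β => if E β then (1 : ℝ) else 0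
  have hset : MeasurableSet {ω : Coins V | E (sampleBits j ω)} := by
    have : {ω | E (sampleBits j ω)}
        = (fun ω : Coins V => if E (sampleBits j ω) then (1 : ℝ) else 0) ⁻¹' {1} := by
      ext ω; by_cases hE : E (sampleBits j ω) <;> simp [hE]
    rw [this]
    exact hmeas (measurableSet_singleton 1)
  have h1 : ∫ ω : Coins V, (if E (sampleBits j ω) then (1 : ℝ) else 0) ∂coinMeasure V
      = (coinMeasure V).real {ω | E (sampleBits j ω)} := by
    rw [← integral_indicator_one hset]
    congr 1
  have h2 : (coinMeasure V).real {ω | E (sampleBits j ω)} ≤ δ := by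
    rw [← h1, integral_listAvg hj l fun β => if E β then (1 : ℝ) else 0]
    calc _ ≤ ∫ _ω : Coins V, δ ∂coinMeasure V :=
          integral_mono (measurable_comp_sampleBits hj _).2 (integrable_const _) fun ω => h _
      _ = δ := by simp
  rw [← ofReal_measureReal]
  exact ENNReal.ofReal_le_ofReal h2

end Bits

/-! ### The primal-dual process with sampled load estimates -/

section RoundDynamics

open Classical

variable {V : Type*} [Fintype V] (G : SimpleGraph V)

/-- The number of neighbours of `v` in `A` whose bit is `true`. -/
noncomputable def sampledCount (A : Finset V) (b : V → Bool) (v : V) : ℕ :=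
  (Finset.univ.filter fun u => G.Adj v u ∧ u ∈ A ∧ b u = true).card

/-- The number of neighbours of `v` in `A`. -/
noncomputable def nbrCount (A : Finset V) (v : V) : ℕ :=
  (Finset.univ.filter fun u => G.Adj v u ∧ u ∈ A).card

/-- The active nodes and the load estimates at the beginning of step `s`. -/
noncomputable def process (g : ℕ → ℝ) (β : ℕ × V → Bool) : ℕ → Finset V × (V → ℝ)
  | 0 => (Finset.univ, 0)
  | s + 1 =>
    let e : V → ℝ := fun v => (process g β s).2 v
      + g s * sampledCount G (process g β s).1 (fun u => β (s, u)) v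
    ((process g β s).1.filter fun v => e v < 1, e)

/-- The active nodes at the beginning of step `s`. -/
noncomputable def activeSet (g : ℕ → ℝ) (β : ℕ × V → Bool) (s : ℕ) : Finset V :=
  (process G g β s).1

/-- The load estimates at the beginning of step `s`. -/
noncomputable def estLoad (g : ℕ → ℝ) (β : ℕ × V → Bool) (s : ℕ) : V → ℝ :=
  (process G g β s).2

/-- The number of active neighbours at step `s`. -/
noncomputable def activeDeg (g : ℕ → ℝ) (β : ℕ × V → Bool) (s : ℕ) (v : V) : ℝ :=
  nbrCount G (activeSet G g β s) v

/-- The number of active neighbours that are sampled at step `s`. -/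
noncomputable def sampledDeg (g : ℕ → ℝ) (β : ℕ × V → Bool) (s : ℕ) (v : V) : ℝ :=
  sampledCount G (activeSet G g β s) (fun u => β (s, u)) v

/-- The increment of the load estimate of `v` at step `s` is off by more than `η s`. -/
def Deviates (g δ η : ℕ → ℝ) (β : ℕ × V → Bool) (s : ℕ) (v : V) : Prop :=
  η s < |g s * sampledDeg G g β s v - δ s * activeDeg G g β s v|

/-- No deviation before step `s`. -/
def Accurate (g δ η : ℕ → ℝ) (β : ℕ × V → Bool) (s : ℕ) (v : V) : Prop :=
  ∀ k < s, ¬ Deviates G g δ η β k v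

/-- The active nodes whose first deviation occurs at step `s`. -/
noncomputable def badSet (g δ η : ℕ → ℝ) (β : ℕ × V → Bool) (s : ℕ) : Finset V :=
  (activeSet G g β s).filter fun v => Accurate G g δ η β s v ∧ Deviates G g δ η β s v

/-- The properties of the edge weights `x s`, their increments `δ s` and the tolerances `η s` that
the analysis uses. -/
structure IsSchedule (ε γ : ℝ) (T : ℕ) (δ x η : ℕ → ℝ) : Prop where
  eps_pos : 0 < ε
  eps_le : ε ≤ 1 / 1000
  gamma_ge : 1 ≤ γ
  gamma_le : γ ≤ 1 + 2 * ε
  delta_nonneg : ∀ s, 0 ≤ δ s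
  x_eq : ∀ s, x s = ∑ k ∈ Finset.range (s + 1), δ k
  x_pos : ∀ s, 0 < x s
  x_le : ∀ s, x s ≤ 2
  x_succ : ∀ s, x (s + 1) ≤ γ * x s
  eta_nonneg : ∀ s, 0 ≤ η s
  eta_sum : ∑ k ∈ Finset.range (T + 1), η k ≤ ε

variable {G} {ε γ : ℝ} {T : ℕ} {g δ x η : ℕ → ℝ} {β : ℕ × V → Bool}

theorem activeSet_zero : activeSet G g β 0 = Finset.univ := rfl

theorem estLoad_succ (s : ℕ) (v : V) :
    estLoad G g β (s + 1) v = estLoad G g β s v + g s * sampledDeg G g β s v := rfl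

theorem mem_activeSet_succ {s : ℕ} {v : V} :
    v ∈ activeSet G g β (s + 1) ↔ v ∈ activeSet G g β s ∧ estLoad G g β (s + 1) v < 1 :=
  Finset.mem_filter

theorem activeSet_antitone : Antitone (activeSet G g β) :=
  antitone_nat_of_succ_le fun _ _ hv => (mem_activeSet_succ.1 hv).1

theorem nbrCount_mono {A B : Finset V} (h : A ⊆ B) (v : V) : nbrCount G A v ≤ nbrCount G B v := by
  refine Finset.card_le_card fun u hu => ?_
  simp only [Finset.mem_filter, Finset.mem_univ, true_and] at hu ⊢
  exact ⟨hu.1, h hu.2⟩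

theorem activeDeg_antitone (v : V) : Antitone fun s => activeDeg G g β s v :=
  fun _ _ h => Nat.cast_le.2 (nbrCount_mono (activeSet_antitone h) v)

theorem activeDeg_nonneg (s : ℕ) (v : V) : 0 ≤ activeDeg G g β s v := Nat.cast_nonneg _

theorem estLoad_eq_sum (s : ℕ) (v : V) :
    estLoad G g β s v = ∑ k ∈ Finset.range s, g k * sampledDeg G g β k v := by
  induction s with
  | zero => rfl
  | succ s ih => rw [Finset.sum_range_succ, ← ih, estLoad_succ]

theorem exists_step_of_notMem_activeSet {n : ℕ} {v : V} (h : v ∉ activeSet G g β n) :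
    ∃ s < n, v ∈ activeSet G g β s ∧ 1 ≤ estLoad G g β (s + 1) v := by
  induction n with
  | zero => exact absurd (Finset.mem_univ v) h
  | succ n ih =>
    by_cases hv : v ∈ activeSet G g β n
    · refine ⟨n, n.lt_succ_self, hv, ?_⟩
      by_contra hlt
      exact h (mem_activeSet_succ.2 ⟨hv, not_le.1 hlt⟩)
    · obtain ⟨s, hs, h'⟩ := ih hv
      exact ⟨s, hs.trans n.lt_succ_self, h'⟩

/-- The true load of `v` at the beginning of step `s`. -/
noncomputable def trueLoad (G : SimpleGraph V) (g δ : ℕ → ℝ) (β : ℕ × V → Bool) (s : ℕ) (v : V) :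
    ℝ :=
  ∑ k ∈ Finset.range s, δ k * activeDeg G g β k v

theorem abs_estLoad_sub_trueLoad_le (hs : IsSchedule ε γ T δ x η) {s : ℕ} (hsT : s ≤ T + 1) {v : V}
    (h : Accurate G g δ η β s v) : |estLoad G g β s v - trueLoad G g δ β s v| ≤ ε := by
  rw [estLoad_eq_sum, trueLoad, ← Finset.sum_sub_distrib]
  refine (Finset.abs_sum_le_sum_abs _ _).trans ?_
  calc _ ≤ ∑ k ∈ Finset.range s, η k :=
        Finset.sum_le_sum fun k hk => not_lt.1 (h k (Finset.mem_range.1 hk))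
    _ ≤ ∑ k ∈ Finset.range (T + 1), η k :=
        Finset.sum_le_sum_of_subset_of_nonneg (Finset.range_mono hsT) fun k _ _ => hs.eta_nonneg k
    _ ≤ ε := hs.eta_sum

theorem x_mul_activeDeg_le (hs : IsSchedule ε γ T δ x η) (s : ℕ) (v : V) :
    x s * activeDeg G g β s v ≤ trueLoad G g δ β (s + 1) v := by
  rw [hs.x_eq, Finset.sum_mul, trueLoad]
  exact Finset.sum_le_sum fun k hk => mul_le_mul_of_nonneg_left
    (activeDeg_antitone v (Nat.lt_succ_iff.1 (Finset.mem_range.1 hk))) (hs.delta_nonneg k)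

theorem trueLoad_succ_le (hs : IsSchedule ε γ T δ x η) (s : ℕ) (v : V) :
    trueLoad G g δ β (s + 2) v ≤ γ * trueLoad G g δ β (s + 1) v := by
  have h1 : trueLoad G g δ β (s + 2) v
      = trueLoad G g δ β (s + 1) v + δ (s + 1) * activeDeg G g β (s + 1) v :=
    Finset.sum_range_succ _ _
  have h2 : δ (s + 1) ≤ (γ - 1) * x s := by
    have := hs.x_succ s
    rw [hs.x_eq (s + 1), Finset.sum_range_succ, ← hs.x_eq] at this
    linarith
  have h3 : δ (s + 1) * activeDeg G g β (s + 1) v ≤ (γ - 1) * (x s * activeDeg G g β s v) := by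
    rw [← mul_assoc]
    exact mul_le_mul h2 (activeDeg_antitone v s.le_succ) (activeDeg_nonneg _ _)
      (mul_nonneg (by linarith [hs.gamma_ge]) (hs.x_pos s).le)
  have h4 := mul_le_mul_of_nonneg_left (x_mul_activeDeg_le (G := G) (g := g) (β := β) hs s v)
    (show 0 ≤ γ - 1 by linarith [hs.gamma_ge])
  linarith

theorem trueLoad_le (hs : IsSchedule ε γ T δ x η) (hx0 : ∀ v, x 0 * activeDeg G g β 0 v ≤ 1)
    {s : ℕ} (hsT : s ≤ T) {v : V} (hv : v ∈ activeSet G g β s) (h : Accurate G g δ η β s v) :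
    trueLoad G g δ β (s + 1) v ≤ γ * (1 + ε) := by
  have he := hs.eps_pos
  have hg := hs.gamma_ge
  cases s with
  | zero =>
    have h1 : trueLoad G g δ β 1 v = x 0 * activeDeg G g β 0 v := by
      simp [trueLoad, hs.x_eq]
    have := hx0 v
    have : (1 : ℝ) * 1 ≤ γ * (1 + ε) := by gcongr; linarith
    simp only [zero_add]
    linarith
  | succ s =>
    refine (trueLoad_succ_le hs s v).trans (mul_le_mul_of_nonneg_left ?_ (by linarith))
    have h1 := abs_le.1 (abs_estLoad_sub_trueLoad_le hs (by omega) h)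
    have h2 := (mem_activeSet_succ.1 hv).2
    linarith [h1.1]

theorem gamma_mul_le (hs : IsSchedule ε γ T δ x η) : γ * (1 + ε) ≤ 1 + 4 * ε := by
  have := hs.eps_pos
  have := hs.eps_le
  have := hs.gamma_le
  nlinarith

theorem activeDeg_le (hs : IsSchedule ε γ T δ x η) (hx0 : ∀ v, x 0 * activeDeg G g β 0 v ≤ 1)
    {s : ℕ} (hsT : s ≤ T) {v : V} (hv : v ∈ activeSet G g β s) (h : Accurate G g δ η β s v) :
    activeDeg G g β s v ≤ 2 / x s := by
  rw [le_div_iff₀ (hs.x_pos s), mul_comm]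
  have := x_mul_activeDeg_le (G := G) (g := g) (β := β) hs s v
  have := trueLoad_le hs hx0 hsT hv h
  have := gamma_mul_le hs
  linarith [hs.eps_le]

theorem mem_badSet {s : ℕ} {v : V} : v ∈ badSet G g δ η β s ↔
    v ∈ activeSet G g β s ∧ Accurate G g δ η β s v ∧ Deviates G g δ η β s v :=
  Finset.mem_filter

theorem accurate_of_notMem_badSet {n : ℕ} {v : V}
    (h : ∀ s < n, v ∈ activeSet G g β s ∧ v ∉ badSet G g δ η β s) : Accurate G g δ η β n v := by
  induction n with
  | zero => intro k hk; omega
  | succ n ih =>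
    have hn := ih fun s hs => h s (by omega)
    intro k hk
    rcases Nat.lt_succ_iff_lt_or_eq.1 hk with hk | rfl
    · exact hn k hk
    · intro hd
      exact (h k hk).2 (mem_badSet.2 ⟨(h k hk).1, hn, hd⟩)

theorem activeDeg_le_sum_of_not_accurate (hs : IsSchedule ε γ T δ x η)
    (hx0 : ∀ v, x 0 * activeDeg G g β 0 v ≤ 1) {n : ℕ} (hn : n ≤ T + 1) {v : V}
    (hv : v ∈ activeSet G g β n) (h : ¬ Accurate G g δ η β n v) :
    activeDeg G g β n v
      ≤ ∑ s ∈ Finset.range n, if v ∈ badSet G g δ η β s then 2 / x s else 0 := by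
  have : ∃ s < n, v ∈ badSet G g δ η β s := by
    by_contra hcon
    push Not at hcon
    exact h (accurate_of_notMem_badSet fun s hs => ⟨activeSet_antitone hs.le hv, hcon s hs⟩)
  obtain ⟨s, hsn, hbad⟩ := this
  have hb := mem_badSet.1 hbad
  calc activeDeg G g β n v ≤ activeDeg G g β s v := activeDeg_antitone v hsn.le
    _ ≤ 2 / x s := activeDeg_le hs hx0 (by omega) hb.1 hb.2.1
    _ = if v ∈ badSet G g δ η β s then 2 / x s else 0 := by rw [if_pos hbad]
    _ ≤ _ := Finset.single_le_sum (f := fun s => if v ∈ badSet G g δ η β s then 2 / x s else 0)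
        (fun k _ => by
          have := hs.x_pos k
          split_ifs <;> positivity) (Finset.mem_range.2 hsn)

theorem sum_not_accurate_le (hs : IsSchedule ε γ T δ x η)
    (hx0 : ∀ v, x 0 * activeDeg G g β 0 v ≤ 1) {n : ℕ} (hn : n ≤ T + 1) :
    ∑ u, (if u ∈ activeSet G g β n ∧ ¬ Accurate G g δ η β n u then activeDeg G g β n u else 0)
      ≤ 2 * ∑ s ∈ Finset.range n, ((badSet G g δ η β s).card : ℝ) / x s := by
  calc _ ≤ ∑ u, ∑ s ∈ Finset.range n, (if u ∈ badSet G g δ η β s then 2 / x s else 0) := by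
        refine Finset.sum_le_sum fun u _ => ?_
        split_ifs with h
        · exact activeDeg_le_sum_of_not_accurate hs hx0 hn h.1 h.2
        · refine Finset.sum_nonneg fun k _ => ?_
          have := hs.x_pos k
          split_ifs <;> positivity
    _ = ∑ s ∈ Finset.range n, ∑ u, (if u ∈ badSet G g δ η β s then 2 / x s else 0) :=
        Finset.sum_comm
    _ = _ := by
        rw [Finset.mul_sum]
        refine Finset.sum_congr rfl fun s _ => ?_
        rw [← Finset.sum_filter, Finset.sum_const, nsmul_eq_mul,
          Finset.filter_mem_eq_inter, Finset.univ_inter]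
        ring

theorem nbrCount_eq_sum (A : Finset V) (v : V) :
    (nbrCount G A v : ℝ) = ∑ u, if G.Adj v u ∧ u ∈ A then (1 : ℝ) else 0 := by
  rw [nbrCount, ← Finset.sum_filter, Finset.sum_const, nsmul_eq_mul, mul_one]

/-- Splitting the pairs of adjacent active nodes according to which endpoint is in a cover. -/
theorem sum_nbrCount_le {C : Finset V} (hC : ∀ u v, G.Adj u v → u ∈ C ∨ v ∈ C) (A : Finset V)
    (P : V → Prop) :
    ∑ v, (if v ∈ A ∧ P v then (nbrCount G A v : ℝ) else 0)
      ≤ 2 * ∑ w ∈ C, (if w ∈ A ∧ P w then (nbrCount G A w : ℝ) else 0)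
        + ∑ u, (if u ∈ A ∧ ¬ P u then (nbrCount G A u : ℝ) else 0) := by
  have hexp : ∀ (Q : V → Prop) [DecidablePred Q], ∑ v, (if Q v then (nbrCount G A v : ℝ) else 0)
      = ∑ v, ∑ u, if Q v ∧ G.Adj v u ∧ u ∈ A then (1 : ℝ) else 0 := fun Q _ => by
    refine Finset.sum_congr rfl fun v _ => ?_
    by_cases h : Q v <;> simp [h, nbrCount_eq_sum]
  have hexp' : ∀ (Q : V → Prop) [DecidablePred Q], ∑ v, (if Q v then (nbrCount G A v : ℝ) else 0)
      = ∑ v, ∑ u, if Q u ∧ G.Adj u v ∧ v ∈ A then (1 : ℝ) else 0 := fun Q _ => by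
    rw [hexp, Finset.sum_comm]
  have hCs : ∑ w ∈ C, (if w ∈ A ∧ P w then (nbrCount G A w : ℝ) else 0)
      = ∑ w, (if w ∈ C ∧ w ∈ A ∧ P w then (nbrCount G A w : ℝ) else 0) := by
    rw [← Finset.sum_filter, ← Finset.sum_filter]
    congr 1
    ext w
    simp
  rw [hCs, two_mul]
  nth_rewrite 2 [hexp']
  rw [hexp, hexp, hexp', ← Finset.sum_add_distrib, ← Finset.sum_add_distrib]
  refine Finset.sum_le_sum fun v _ => ?_
  rw [← Finset.sum_add_distrib, ← Finset.sum_add_distrib]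
  refine Finset.sum_le_sum fun u _ => ?_
  have hn : ∀ (Q : Prop) [Decidable Q], (0 : ℝ) ≤ if Q then 1 else 0 := fun Q _ => by split_ifs <;> norm_num
  by_cases h : (v ∈ A ∧ P v) ∧ G.Adj v u ∧ u ∈ A
  · rw [if_pos h]
    obtain ⟨⟨hvA, hvP⟩, hadj, huA⟩ := h
    by_cases huP : P u
    · rcases hC v u hadj with hc | hc
      · rw [if_pos (show (v ∈ C ∧ v ∈ A ∧ P v) ∧ G.Adj v u ∧ u ∈ A from
          ⟨⟨hc, hvA, hvP⟩, hadj, huA⟩)]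
        exact le_add_of_le_of_nonneg (le_add_of_nonneg_left (hn _)) (hn _)
      · rw [if_pos (show (u ∈ C ∧ u ∈ A ∧ P u) ∧ G.Adj u v ∧ v ∈ A from
          ⟨⟨hc, huA, huP⟩, hadj.symm, hvA⟩)]
        exact le_add_of_le_of_nonneg (le_add_of_nonneg_right (hn _)) (hn _)
    · rw [if_pos (show (u ∈ A ∧ ¬ P u) ∧ G.Adj u v ∧ v ∈ A from ⟨⟨huA, huP⟩, hadj.symm, hvA⟩)]
      exact le_add_of_nonneg_left (add_nonneg (hn _) (hn _))
  · rw [if_neg h]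
    exact add_nonneg (add_nonneg (hn _) (hn _)) (hn _)

theorem sum_accurate_load_le (hs : IsSchedule ε γ T δ x η)
    (hx0 : ∀ v, x 0 * activeDeg G g β 0 v ≤ 1) (w : V) :
    ∑ k ∈ Finset.range (T + 1), δ k * (if w ∈ activeSet G g β k ∧ Accurate G g δ η β k w
      then activeDeg G g β k w else 0) ≤ γ * (1 + ε) := by
  have key : ∀ n ≤ T + 1, ∑ k ∈ Finset.range n, δ k * (if w ∈ activeSet G g β k ∧
      Accurate G g δ η β k w then activeDeg G g β k w else 0) ≤ γ * (1 + ε) := by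
    intro n hn
    induction n with
    | zero =>
      have := hs.eps_pos
      have := hs.gamma_ge
      simp only [Finset.range_zero, Finset.sum_empty]
      positivity
    | succ n ih =>
      by_cases h : w ∈ activeSet G g β n ∧ Accurate G g δ η β n w
      · refine le_trans (Finset.sum_le_sum fun k _ => mul_le_mul_of_nonneg_left ?_
          (hs.delta_nonneg k)) (trueLoad_le hs hx0 (by omega) h.1 h.2)
        split_ifs
        exacts [le_rfl, activeDeg_nonneg _ _]
      · rw [Finset.sum_range_succ, if_neg h, mul_zero, add_zero]
        exact ih (by omega)
  exact key _ le_rfl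

/-- If few nodes deviate, then the process ends with a small cover. -/
theorem card_compl_activeSet_le (hs : IsSchedule ε γ T δ x η)
    (hx0 : ∀ v, x 0 * activeDeg G g β 0 v ≤ 1)
    {C : Finset V} (hC : ∀ u v, G.Adj u v → u ∈ C ∨ v ∈ C)
    (hbad : ∑ s ∈ Finset.range (T + 1), ((badSet G g δ η β s).card : ℝ) / x s ≤ ε * C.card) :
    (((activeSet G g β (T + 1))ᶜ).card : ℝ) ≤ (2 + 100 * ε) * C.card := by
  have he := hs.eps_pos
  have he' := hs.eps_le
  set W := ∑ s ∈ Finset.range (T + 1), ((badSet G g δ η β s).card : ℝ) / x s with hW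
  set B : Finset V := (Finset.range (T + 1)).biUnion (badSet G g δ η β) with hB
  have hBW : (B.card : ℝ) ≤ 2 * W := by
    refine (Nat.cast_le.2 Finset.card_biUnion_le).trans ?_
    rw [Nat.cast_sum, hW, Finset.mul_sum]
    refine Finset.sum_le_sum fun s _ => ?_
    rw [← mul_div_assoc, le_div_iff₀ (hs.x_pos s), mul_comm]
    exact mul_le_mul_of_nonneg_right (hs.x_le s) (Nat.cast_nonneg _)
  have hW0 : 0 ≤ W := by linarith [(Nat.cast_nonneg B.card : (0 : ℝ) ≤ B.card)]
  have hterm : ∀ v ∈ (activeSet G g β (T + 1))ᶜ \ B, 1 - ε ≤ ∑ k ∈ Finset.range (T + 1),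
      δ k * (if v ∈ activeSet G g β k ∧ Accurate G g δ η β k v then activeDeg G g β k v else 0) := by
    intro v hv
    rw [Finset.mem_sdiff, Finset.mem_compl] at hv
    obtain ⟨s, hsT, hvs, hest⟩ := exists_step_of_notMem_activeSet hv.1
    have hacc : Accurate G g δ η β (s + 1) v := accurate_of_notMem_badSet fun k hk =>
      ⟨activeSet_antitone (Nat.lt_succ_iff.1 hk) hvs, fun hb =>
        hv.2 (Finset.mem_biUnion.2 ⟨k, Finset.mem_range.2 (by omega), hb⟩)⟩
    have h1 := abs_le.1 (abs_estLoad_sub_trueLoad_le hs (by omega) hacc)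
    have h2 : trueLoad G g δ β (s + 1) v ≤ ∑ k ∈ Finset.range (T + 1),
        δ k * (if v ∈ activeSet G g β k ∧ Accurate G g δ η β k v then activeDeg G g β k v
          else 0) := by
      calc _ = ∑ k ∈ Finset.range (s + 1), δ k * (if v ∈ activeSet G g β k ∧
            Accurate G g δ η β k v then activeDeg G g β k v else 0) := by
            refine Finset.sum_congr rfl fun k hk => ?_
            have hk' := Nat.lt_succ_iff.1 (Finset.mem_range.1 hk)
            rw [if_pos ⟨activeSet_antitone hk' hvs, fun l hl => hacc l (by omega)⟩]
        _ ≤ _ := by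
            refine Finset.sum_le_sum_of_subset_of_nonneg (Finset.range_mono (by omega))
              fun k _ _ => mul_nonneg (hs.delta_nonneg k) ?_
            split_ifs
            exacts [activeDeg_nonneg _ _, le_rfl]
    linarith [h1.2]
  have hnn : ∀ v, 0 ≤ ∑ k ∈ Finset.range (T + 1),
      δ k * (if v ∈ activeSet G g β k ∧ Accurate G g δ η β k v then activeDeg G g β k v else 0) :=
    fun v => Finset.sum_nonneg fun k _ => mul_nonneg (hs.delta_nonneg k) (by
      split_ifs
      exacts [activeDeg_nonneg _ _, le_rfl])
  have hsumx : ∑ k ∈ Finset.range (T + 1), δ k ≤ 2 := (hs.x_eq T).symm.trans_le (hs.x_le T)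
  have hWk : ∀ k ∈ Finset.range (T + 1),
      2 * ∑ s ∈ Finset.range k, ((badSet G g δ η β s).card : ℝ) / x s ≤ 2 * W := fun k hk =>
    mul_le_mul_of_nonneg_left (Finset.sum_le_sum_of_subset_of_nonneg
      (Finset.range_mono (Finset.mem_range.1 hk).le) fun s _ _ =>
        div_nonneg (Nat.cast_nonneg _) (hs.x_pos s).le) (by norm_num)
  clear_value W
  have hmain : (((activeSet G g β (T + 1))ᶜ \ B).card : ℝ) * (1 - ε)
      ≤ 2 * (C.card * (γ * (1 + ε))) + 2 * (2 * W) := by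
    calc (((activeSet G g β (T + 1))ᶜ \ B).card : ℝ) * (1 - ε)
        = ∑ v ∈ (activeSet G g β (T + 1))ᶜ \ B, (1 - ε) := by
          rw [Finset.sum_const, nsmul_eq_mul]
      _ ≤ ∑ v, ∑ k ∈ Finset.range (T + 1), δ k * (if v ∈ activeSet G g β k ∧
            Accurate G g δ η β k v then activeDeg G g β k v else 0) :=
          (Finset.sum_le_sum hterm).trans (Finset.sum_le_sum_of_subset_of_nonneg
            (Finset.subset_univ _) fun v _ _ => hnn v)
      _ = ∑ k ∈ Finset.range (T + 1), δ k * ∑ v, (if v ∈ activeSet G g β k ∧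
            Accurate G g δ η β k v then activeDeg G g β k v else 0) := by
          rw [Finset.sum_comm]
          exact Finset.sum_congr rfl fun k _ => (Finset.mul_sum _ _ _).symm
      _ ≤ ∑ k ∈ Finset.range (T + 1), δ k * (2 * ∑ w ∈ C, (if w ∈ activeSet G g β k ∧
            Accurate G g δ η β k w then activeDeg G g β k w else 0) + 2 * W) := by
          refine Finset.sum_le_sum fun k hk => mul_le_mul_of_nonneg_left ?_ (hs.delta_nonneg k)
          refine (sum_nbrCount_le hC _ _).trans (add_le_add le_rfl ?_)
          exact (sum_not_accurate_le hs hx0 (Finset.mem_range.1 hk).le).trans (hWk k hk)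
      _ = 2 * ∑ w ∈ C, ∑ k ∈ Finset.range (T + 1), δ k * (if w ∈ activeSet G g β k ∧
            Accurate G g δ η β k w then activeDeg G g β k w else 0)
            + (∑ k ∈ Finset.range (T + 1), δ k) * (2 * W) := by
          rw [Finset.sum_comm, Finset.mul_sum, Finset.sum_mul, ← Finset.sum_add_distrib]
          refine Finset.sum_congr rfl fun k _ => ?_
          rw [← Finset.mul_sum]
          ring
      _ ≤ 2 * (C.card * (γ * (1 + ε))) + 2 * (2 * W) := by
          refine add_le_add (mul_le_mul_of_nonneg_left ?_ (by norm_num))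
            (mul_le_mul_of_nonneg_right hsumx (by linarith))
          rw [← nsmul_eq_mul]
          exact Finset.sum_le_card_nsmul _ _ _ fun w _ => sum_accurate_load_le hs hx0 w
  have hcard : (((activeSet G g β (T + 1))ᶜ).card : ℝ)
      ≤ ((activeSet G g β (T + 1))ᶜ \ B).card + B.card := by
    exact_mod_cast Finset.card_le_card_sdiff_add_card
  have hgam := gamma_mul_le hs
  have hc0 : (0 : ℝ) ≤ C.card := Nat.cast_nonneg _
  set N := (((activeSet G g β (T + 1))ᶜ \ B).card : ℝ)
  have h3 : N * (1 - ε) ≤ (2 + 12 * ε) * C.card := by nlinarith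
  have h4 : N ≤ (2 + 20 * ε) * C.card := by
    by_contra hcon
    push Not at hcon
    have : (2 + 20 * ε) * C.card * (1 - ε) < N * (1 - ε) :=
      mul_lt_mul_of_pos_right hcon (by linarith)
    nlinarith [mul_nonneg hc0 he.le, mul_nonneg (mul_nonneg hc0 he.le) (sub_nonneg.2 he')]
  nlinarith

/-- The accurate active nodes that still have active neighbours are few. -/
theorem card_candidates_le (hs : IsSchedule ε γ T δ x η)
    (hx0 : ∀ v, x 0 * activeDeg G g β 0 v ≤ 1)
    {C : Finset V} (hC : ∀ u v, G.Adj u v → u ∈ C ∨ v ∈ C) {n : ℕ} (hn : n ≤ T)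
    (hbad : ∑ s ∈ Finset.range n, ((badSet G g δ η β s).card : ℝ) / x s ≤ C.card) :
    (((activeSet G g β n).filter fun v => 0 < activeDeg G g β n v).card : ℝ)
      ≤ 8 * C.card / x n := by
  have hxn := hs.x_pos n
  set A := activeSet G g β n with hA
  have hsub : (A.filter fun v => 0 < activeDeg G g β n v)
      ⊆ C ∪ (C.filter (· ∈ A)).biUnion fun w => Finset.univ.filter fun u => G.Adj w u ∧ u ∈ A := by
    intro v hv
    rw [Finset.mem_filter] at hv
    rw [Finset.mem_union]
    by_contra hcon
    push Not at hcon
    have hpos : 0 < nbrCount G A v := Nat.cast_pos.1 hv.2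
    obtain ⟨u, hu⟩ := Finset.card_pos.1 hpos
    simp only [Finset.mem_filter, Finset.mem_univ, true_and] at hu
    refine hcon.2 (Finset.mem_biUnion.2 ⟨u, Finset.mem_filter.2
      ⟨(hC v u hu.1).resolve_left hcon.1, hu.2⟩, ?_⟩)
    simp only [Finset.mem_filter, Finset.mem_univ, true_and]
    exact ⟨hu.1.symm, hv.1⟩
  have h1 : ((A.filter fun v => 0 < activeDeg G g β n v).card : ℝ)
      ≤ C.card + ∑ w ∈ C.filter (· ∈ A), activeDeg G g β n w := by
    have := (Finset.card_le_card hsub).trans ((Finset.card_union_le _ _).trans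
      (add_le_add le_rfl Finset.card_biUnion_le))
    have this := (Nat.cast_le (α := ℝ)).2 this
    rw [Nat.cast_add, Nat.cast_sum] at this
    exact this
  have h2 : ∑ w ∈ C.filter (· ∈ A), activeDeg G g β n w
      ≤ C.card * (2 / x n) + 2 * ∑ s ∈ Finset.range n, ((badSet G g δ η β s).card : ℝ) / x s := by
    have hsplit : ∀ w ∈ C.filter (· ∈ A), activeDeg G g β n w ≤ 2 / x n
        + if w ∈ A ∧ ¬ Accurate G g δ η β n w then activeDeg G g β n w else 0 := by
      intro w hw
      by_cases hacc : Accurate G g δ η β n w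
      · rw [if_neg (fun h => h.2 hacc), add_zero]
        exact activeDeg_le hs hx0 hn (Finset.mem_filter.1 hw).2 hacc
      · rw [if_pos ⟨(Finset.mem_filter.1 hw).2, hacc⟩]
        exact le_add_of_nonneg_left (by positivity)
    refine (Finset.sum_le_sum hsplit).trans ?_
    rw [Finset.sum_add_distrib]
    refine add_le_add ?_ ((Finset.sum_le_sum_of_subset_of_nonneg (Finset.subset_univ _)
      fun u _ _ => ?_).trans (sum_not_accurate_le hs hx0 (by omega)))
    · rw [Finset.sum_const, nsmul_eq_mul]
      exact mul_le_mul_of_nonneg_right (Nat.cast_le.2 (Finset.card_filter_le _ _)) (by positivity)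
    · split_ifs
      exacts [activeDeg_nonneg _ _, le_rfl]
  have h3 : (C.card : ℝ) ≤ 2 * C.card / x n := by
    rw [le_div_iff₀ hxn]
    nlinarith [hs.x_le n, (Nat.cast_nonneg C.card : (0 : ℝ) ≤ C.card)]
  have h4 : 8 * C.card / x n = C.card * (2 / x n) + 3 * (2 * C.card / x n) := by ring
  linarith

end RoundDynamics

/-! ### Concentration in a single step -/

section LinearTail

variable {ι : Type*} [DecidableEq ι] {p : ι → ℝ}

theorem listAvg_linear (s : Finset ι) (c : ι → ℝ) (β₀ : ι → Bool) :
    listAvg p s.toList (fun β => ∑ i ∈ s, c i * if β i then 1 else 0) β₀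
      = ∑ i ∈ s, c i * p i := by
  rw [listAvg_sum]
  refine Finset.sum_congr rfl fun i hi => ?_
  exact (congrFun (listAvg_const_mul _ _ _) β₀).trans
    (congrArg _ (listAvg_coord s.nodup_toList (Finset.mem_toList.2 hi) β₀))

theorem boundedDiff_linear (s : Finset ι) (c : ι → ℝ) {i : ι} (hi : i ∈ s) :
    BoundedDiff (fun β : ι → Bool => ∑ i ∈ s, c i * if β i then (1 : ℝ) else 0) i |c i| := by
  intro β
  have : (∑ k ∈ s, c k * if Function.update β i true k then (1 : ℝ) else 0)
      - (∑ k ∈ s, c k * if Function.update β i false k then (1 : ℝ) else 0) = c i := by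
    rw [← Finset.sum_sub_distrib, Finset.sum_eq_single_of_mem i hi]
    · simp
    · intro k _ hk
      simp [Function.update_of_ne hk]
  rw [this]

theorem linear_upper_tail (hp : ∀ i, p i ∈ Set.Icc (0 : ℝ) 1) (s : Finset ι) (c : ι → ℝ)
    {S t : ℝ} (hS : 0 < S) (ht : 0 ≤ t) (hcS : ∑ i ∈ s, c i ^ 2 ≤ S) (β₀ : ι → Bool)
    {E : (ι → Bool) → ℝ} (hE : ∀ β, E β ≤ 1)
    (hE' : ∀ β, (∑ i ∈ s, c i * if β i then 1 else 0) < ∑ i ∈ s, c i * p i + t → E β ≤ 0) :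
    listAvg p s.toList E β₀ ≤ Real.exp (-(t ^ 2 / (4 * S))) := by
  refine listAvg_upper_tail hp s.toList (c := fun i => |c i|)
    (fun i hi => boundedDiff_linear s c (Finset.mem_toList.1 hi)) hS ht ?_ β₀ hE ?_
  · simpa [sq_abs] using hcS
  · rw [listAvg_linear]
    exact hE'

end LinearTail

section StepProbability

open Classical

variable {V : Type*} [Fintype V] {G : SimpleGraph V} {ε γ : ℝ} {T : ℕ} {g δ x η : ℕ → ℝ}

theorem sampledCount_eq_sum (A : Finset V) (b : V → Bool) (v : V) :
    (sampledCount G A b v : ℝ)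
      = ∑ u, (if G.Adj v u ∧ u ∈ A then (1 : ℝ) else 0) * if b u then 1 else 0 := by
  rw [sampledCount, ← nsmul_one, ← Finset.sum_const, Finset.sum_filter]
  refine Finset.sum_congr rfl fun u _ => ?_
  by_cases h1 : G.Adj v u <;> by_cases h2 : u ∈ A <;> by_cases h3 : b u <;> simp [h1, h2, h3]

/-- The count of sampled neighbours is off by more than `t`, in units of `g₀`. -/
def CountDeviates (G : SimpleGraph V) (g₀ d₀ t : ℝ) (A : Finset V) (v : V) (b : V → Bool) : Prop :=
  t < |g₀ * sampledCount G A b v - d₀ * nbrCount G A v|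

theorem listAvg_countDeviates_le {q : ℝ} (hq : q ∈ Set.Icc (0 : ℝ) 1) {g₀ d₀ t S : ℝ}
    (hd : g₀ * q = d₀) (ht : 0 ≤ t) (hS : 0 < S) (A : Finset V) (v : V)
    (hcS : nbrCount G A v * g₀ ^ 2 ≤ S) (b₀ : V → Bool) :
    listAvg (fun _ => q) Finset.univ.toList
      (fun b => if CountDeviates G g₀ d₀ t A v b then 1 else 0) b₀
      ≤ 2 * Real.exp (-(t ^ 2 / (4 * S))) := by
  let c : V → ℝ := fun u => g₀ * if G.Adj v u ∧ u ∈ A then (1 : ℝ) else 0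
  have hsum : ∀ b : V → Bool, (∑ u, c u * if b u then (1 : ℝ) else 0)
      = g₀ * sampledCount G A b v := fun b => by
    rw [sampledCount_eq_sum, Finset.mul_sum]
    exact Finset.sum_congr rfl fun u _ => mul_assoc _ _ _
  have hmean : ∑ u, c u * q = d₀ * nbrCount G A v := by
    rw [← Finset.sum_mul, nbrCount_eq_sum, ← Finset.mul_sum, ← hd]
    ring
  have hsq : ∑ u, c u ^ 2 ≤ S := by
    refine le_trans (le_of_eq ?_) hcS
    rw [nbrCount_eq_sum, Finset.sum_mul]
    refine Finset.sum_congr rfl fun u _ => ?_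
    by_cases h : G.Adj v u ∧ u ∈ A <;> simp [c, h]
  have hup := linear_upper_tail (p := fun _ : V => q) (fun _ => hq) Finset.univ c hS ht hsq b₀
    (E := fun b => if t < g₀ * sampledCount G A b v - d₀ * nbrCount G A v then 1 else 0)
    (fun b => by split_ifs <;> norm_num)
    (fun b hb => by
      rw [hsum, hmean] at hb
      rw [if_neg (by linarith)])
  have hlow := linear_upper_tail (p := fun _ : V => q) (fun _ => hq) Finset.univ (fun u => -c u)
    hS ht (by simpa using hsq) b₀
    (E := fun b => if t < -(g₀ * sampledCount G A b v - d₀ * nbrCount G A v) then 1 else 0)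
    (fun b => by split_ifs <;> norm_num)
    (fun b hb => by
      simp only [neg_mul, Finset.sum_neg_distrib] at hb
      rw [hsum, hmean] at hb
      rw [if_neg (by linarith)])
  rw [two_mul]
  refine le_trans ?_ (add_le_add hup hlow)
  have hadd := congrFun (listAvg_add (p := fun _ : V => q) Finset.univ.toList
    (fun b => if t < g₀ * sampledCount G A b v - d₀ * nbrCount G A v then 1 else 0)
    (fun b => if t < -(g₀ * sampledCount G A b v - d₀ * nbrCount G A v) then 1 else 0)) b₀
  refine le_trans (listAvg_mono (fun _ => hq) _ (fun b => ?_) b₀) (le_of_eq hadd)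
  by_cases h : CountDeviates G g₀ d₀ t A v b
  · rw [if_pos h]
    rcases lt_abs.1 h with h | h
    · rw [if_pos h]
      split_ifs <;> norm_num
    · rw [if_pos h]
      split_ifs <;> norm_num
  · rw [if_neg h]
    split_ifs <;> norm_num

theorem process_setSlice {β : ℕ × V → Bool} {s : ℕ} (b : V → Bool) {k : ℕ} (hk : k ≤ s) :
    process G g (setSlice β s b) k = process G g β k := by
  induction k with
  | zero => rfl
  | succ k ih =>
    have h1 : (fun u => setSlice β s b (k, u)) = fun u => β (k, u) :=
      funext fun u => setSlice_of_ne (by omega) b u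
    simp only [process, ih (by omega), h1]

theorem activeSet_setSlice {β : ℕ × V → Bool} {s : ℕ} (b : V → Bool) {k : ℕ} (hk : k ≤ s) :
    activeSet G g (setSlice β s b) k = activeSet G g β k :=
  congrArg Prod.fst (process_setSlice b hk)

theorem activeDeg_setSlice {β : ℕ × V → Bool} {s : ℕ} (b : V → Bool) {k : ℕ} (hk : k ≤ s) (v : V) :
    activeDeg G g (setSlice β s b) k v = activeDeg G g β k v := by
  rw [activeDeg, activeSet_setSlice b hk, activeDeg]

theorem deviates_setSlice {β : ℕ × V → Bool} {s : ℕ} (b : V → Bool) {k : ℕ} (hk : k < s) (v : V) :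
    Deviates G g δ η (setSlice β s b) k v ↔ Deviates G g δ η β k v := by
  have h1 : (fun u => setSlice β s b (k, u)) = fun u => β (k, u) :=
    funext fun u => setSlice_of_ne hk.ne b u
  rw [Deviates, activeDeg_setSlice b hk.le, sampledDeg, activeSet_setSlice b hk.le, h1]
  rfl

theorem deviates_setSlice_self {β : ℕ × V → Bool} {s : ℕ} (b : V → Bool) (v : V) :
    Deviates G g δ η (setSlice β s b) s v
      ↔ CountDeviates G (g s) (δ s) (η s) (activeSet G g β s) v b := by
  rw [Deviates, activeDeg_setSlice b le_rfl, sampledDeg, activeSet_setSlice b le_rfl,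
    setSlice_self]
  rfl

theorem accurate_setSlice {β : ℕ × V → Bool} {s : ℕ} (b : V → Bool) {k : ℕ} (hk : k ≤ s) (v : V) :
    Accurate G g δ η (setSlice β s b) k v ↔ Accurate G g δ η β k v :=
  forall₂_congr fun l hl => not_congr (deviates_setSlice b (by omega) v)

theorem badSet_setSlice {β : ℕ × V → Bool} {s : ℕ} (b : V → Bool) {k : ℕ} (hk : k < s) :
    badSet G g δ η (setSlice β s b) k = badSet G g δ η β k := by
  ext v
  rw [mem_badSet, mem_badSet, activeSet_setSlice b hk.le, accurate_setSlice b hk.le,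
    deviates_setSlice b hk]

theorem mem_badSet_setSlice {β : ℕ × V → Bool} {s : ℕ} (b : V → Bool) {v : V} :
    v ∈ badSet G g δ η (setSlice β s b) s ↔ v ∈ activeSet G g β s ∧ Accurate G g δ η β s v ∧
      CountDeviates G (g s) (δ s) (η s) (activeSet G g β s) v b := by
  rw [mem_badSet, activeSet_setSlice b le_rfl, accurate_setSlice b le_rfl, deviates_setSlice_self]

/-- The coordinates of step `s`. -/
noncomputable def stepList (V : Type*) [Fintype V] (s : ℕ) : List (ℕ × V) :=
  Finset.univ.toList.map fun v => (s, v)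

variable {j : ℕ → ℕ} {S : ℝ}

theorem listAvg_countDeviates_le_of_accurate (hs : IsSchedule ε γ T δ x η) {β : ℕ × V → Bool}
    (hx0 : ∀ v, x 0 * activeDeg G g β 0 v ≤ 1) {s : ℕ} (hsT : s ≤ T)
    (hg : g s * (1 / 2) ^ j s = δ s) (hS : 0 < S) (hgS : 2 / x s * g s ^ 2 ≤ S) {v : V}
    (hv : v ∈ activeSet G g β s) (hacc : Accurate G g δ η β s v) (b₀ : V → Bool) :
    listAvg (fun _ => (1 / 2) ^ j s) Finset.univ.toList
      (fun b => if CountDeviates G (g s) (δ s) (η s) (activeSet G g β s) v b then 1 else 0) b₀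
      ≤ 2 * Real.exp (-(η s ^ 2 / (4 * S))) :=
  listAvg_countDeviates_le (bitProb_mem (V := V) j (s, v)) hg (hs.eta_nonneg s) hS _ _
    ((mul_le_mul_of_nonneg_right (activeDeg_le hs hx0 hsT hv hacc) (sq_nonneg _)).trans hgS) _

/-- With many active neighbours per node it is unlikely that any node deviates. -/
theorem listAvg_badSet_nonempty_le (hs : IsSchedule ε γ T δ x η) {β : ℕ × V → Bool}
    (hx0 : ∀ v, x 0 * activeDeg G g β 0 v ≤ 1) {s : ℕ} (hsT : s ≤ T)
    (hg : g s * (1 / 2) ^ j s = δ s) (hS : 0 < S) (hgS : 2 / x s * g s ^ 2 ≤ S) :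
    listAvg (bitProb j) (stepList V s)
      (fun β => if (badSet G g δ η β s).Nonempty then 1 else 0) β
      ≤ Fintype.card V * (2 * Real.exp (-(η s ^ 2 / (4 * S)))) := by
  rw [stepList, listAvg_slice]
  set A := activeSet G g β s
  have hmono := listAvg_mono (p := fun v : V => bitProb j (s, v)) (fun v => bitProb_mem j (s, v))
    Finset.univ.toList
    (F := fun b => if (badSet G g δ η (setSlice β s b) s).Nonempty then 1 else 0)
    (H := fun b => ∑ v ∈ A.filter (Accurate G g δ η β s),
      if CountDeviates G (g s) (δ s) (η s) A v b then (1 : ℝ) else 0)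
    (fun b => by
      have hnn : ∀ v ∈ A.filter (Accurate G g δ η β s),
          (0 : ℝ) ≤ if CountDeviates G (g s) (δ s) (η s) A v b then (1 : ℝ) else 0 :=
        fun v _ => by split_ifs <;> norm_num
      split_ifs with h
      · obtain ⟨v, hv⟩ := h
        rw [mem_badSet_setSlice] at hv
        refine le_trans ?_ (Finset.single_le_sum hnn (Finset.mem_filter.2 ⟨hv.1, hv.2.1⟩))
        rw [if_pos hv.2.2]
      · exact Finset.sum_nonneg hnn) (fun v => β (s, v))
  refine hmono.trans ?_
  rw [listAvg_sum]
  refine (Finset.sum_le_card_nsmul _ _ _ fun v hv =>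
    listAvg_countDeviates_le_of_accurate hs hx0 hsT hg hS hgS (Finset.mem_filter.1 hv).1
      (Finset.mem_filter.1 hv).2 _).trans ?_
  rw [nsmul_eq_mul]
  exact mul_le_mul_of_nonneg_right (Nat.cast_le.2 (Finset.card_le_univ _)) (by positivity)

theorem sampledCount_update {A : Finset V} {v u : V} (h : ¬ (G.Adj v u ∧ u ∈ A)) (b : V → Bool)
    (y : Bool) : sampledCount G A (Function.update b u y) v = sampledCount G A b v := by
  unfold sampledCount
  congr 1
  ext w
  by_cases hw : w = u
  · subst hw
    simp only [Finset.mem_filter, Finset.mem_univ, true_and]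
    tauto
  · simp [Function.update_of_ne hw]

/-- With bounded degrees it is unlikely that many nodes deviate. -/
theorem listAvg_card_badSet_gt_le (hs : IsSchedule ε γ T δ x η) {β : ℕ × V → Bool}
    (hx0 : ∀ (β : ℕ × V → Bool) v, x 0 * activeDeg G g β 0 v ≤ 1)
    {C : Finset V} (hC : ∀ u v, G.Adj u v → u ∈ C ∨ v ∈ C) {s : ℕ} (hsT : s ≤ T)
    (hg : g s * (1 / 2) ^ j s = δ s) (hS : 0 < S) (hgS : 2 / x s * g s ^ 2 ≤ S)
    {q S' t : ℝ} (hq : 0 ≤ q) (hS' : 0 < S') (hqS : q * (16 * C.card / x s ^ 2) ≤ S')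
    (ht : 0 ≤ t) :
    listAvg (bitProb j) (stepList V s)
      (fun β => if (∑ k ∈ Finset.range s, ((badSet G g δ η β k).card : ℝ) / x k ≤ C.card) ∧
        (∀ u ∈ activeSet G g β s, activeDeg G g β s u ≤ q) ∧
        8 * C.card / x s * (2 * Real.exp (-(η s ^ 2 / (4 * S)))) + t < (badSet G g δ η β s).card
        then 1 else 0) β
      ≤ Real.exp (-(t ^ 2 / (4 * S'))) := by
  rw [stepList, listAvg_slice]
  set A := activeSet G g β s with hA
  have hdeg : ∀ b : V → Bool, (∀ u ∈ activeSet G g (setSlice β s b) s,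
      activeDeg G g (setSlice β s b) s u ≤ q) ↔ ∀ u ∈ A, activeDeg G g β s u ≤ q := fun b => by
    simp only [activeSet_setSlice b le_rfl, activeDeg_setSlice b le_rfl, hA]
  have hpre : ∀ b : V → Bool,
      (∑ k ∈ Finset.range s, ((badSet G g δ η (setSlice β s b) k).card : ℝ) / x k)
        = ∑ k ∈ Finset.range s, ((badSet G g δ η β k).card : ℝ) / x k := fun b =>
    Finset.sum_congr rfl fun k hk => by rw [badSet_setSlice b (Finset.mem_range.1 hk)]
  simp only [hdeg, hpre]
  by_cases hhist : (∑ k ∈ Finset.range s, ((badSet G g δ η β k).card : ℝ) / x k ≤ C.card) ∧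
      (∀ u ∈ A, activeDeg G g β s u ≤ q)
  swap
  · have h0 : ∀ b : V → Bool, ¬ ((∑ k ∈ Finset.range s, ((badSet G g δ η β k).card : ℝ) / x k
        ≤ C.card) ∧ (∀ u ∈ A, activeDeg G g β s u ≤ q) ∧
        8 * C.card / x s * (2 * Real.exp (-(η s ^ 2 / (4 * S)))) + t
          < (badSet G g δ η (setSlice β s b) s).card) := fun b h => hhist ⟨h.1, h.2.1⟩
    simp only [h0, if_false, listAvg_const]
    exact (Real.exp_pos _).le
  set K := (A.filter fun v => 0 < activeDeg G g β s v).filter (Accurate G g δ η β s) with hK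
  have hKmem : ∀ v ∈ K, v ∈ A ∧ 0 < activeDeg G g β s v ∧ Accurate G g δ η β s v := fun v hv => by
    rw [hK, Finset.mem_filter, Finset.mem_filter] at hv
    exact ⟨hv.1.1, hv.1.2, hv.2⟩
  have hKcard : (K.card : ℝ) ≤ 8 * C.card / x s :=
    (Nat.cast_le.2 (Finset.card_filter_le _ _)).trans
      (card_candidates_le hs (hx0 β) hC hsT hhist.1)
  have hxs := hs.x_pos s
  let F : (V → Bool) → ℝ := fun b =>
    ∑ v ∈ K, if CountDeviates G (g s) (δ s) (η s) A v b then (1 : ℝ) else 0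
  let c : V → ℝ := fun u => ∑ v ∈ K, if G.Adj v u ∧ u ∈ A then (1 : ℝ) else 0
  have hbad : ∀ b, ((badSet G g δ η (setSlice β s b) s).card : ℝ) ≤ F b := fun b => by
    have : badSet G g δ η (setSlice β s b) s
        ⊆ K.filter fun v => CountDeviates G (g s) (δ s) (η s) A v b := fun v hv => by
      rw [mem_badSet_setSlice] at hv
      refine Finset.mem_filter.2 ⟨Finset.mem_filter.2 ⟨Finset.mem_filter.2 ⟨hv.1, ?_⟩, hv.2.1⟩,
        hv.2.2⟩
      refine lt_of_le_of_ne (activeDeg_nonneg _ _) fun h0 => ?_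
      have h1 : (nbrCount G A v : ℝ) = 0 := h0.symm
      have h2 : (sampledCount G A b v : ℝ) ≤ nbrCount G A v := Nat.cast_le.2 <|
        Finset.card_le_card fun u hu => by
          simp only [Finset.mem_filter, Finset.mem_univ, true_and] at hu ⊢
          exact ⟨hu.1, hu.2.1⟩
      have h3 : (sampledCount G A b v : ℝ) = 0 :=
        le_antisymm (h2.trans h1.le) (Nat.cast_nonneg _)
      have h4 := hv.2.2
      rw [CountDeviates, h1, h3] at h4
      simp only [mul_zero, sub_zero, abs_zero] at h4
      exact (hs.eta_nonneg s).not_gt h4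
    refine (Nat.cast_le.2 (Finset.card_le_card this)).trans (le_of_eq ?_)
    rw [← nsmul_one, ← Finset.sum_const, Finset.sum_filter]
  have hmean : listAvg (fun v => bitProb j (s, v)) Finset.univ.toList F (fun v => β (s, v))
      ≤ 8 * C.card / x s * (2 * Real.exp (-(η s ^ 2 / (4 * S)))) := by
    rw [listAvg_sum]
    refine (Finset.sum_le_card_nsmul _ _ _ fun v hv =>
      listAvg_countDeviates_le_of_accurate hs (hx0 β) hsT hg hS hgS (hKmem v hv).1
        (hKmem v hv).2.2 _).trans ?_
    rw [nsmul_eq_mul]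
    exact mul_le_mul_of_nonneg_right hKcard (by positivity)
  have hc0 : ∀ u, 0 ≤ c u := fun u =>
    Finset.sum_nonneg fun v _ => by split_ifs <;> norm_num
  have hdiff : ∀ u, BoundedDiff F u (c u) := fun u b => by
    rw [← Finset.sum_sub_distrib]
    refine (Finset.abs_sum_le_sum_abs _ _).trans (Finset.sum_le_sum fun v _ => ?_)
    by_cases h : G.Adj v u ∧ u ∈ A
    · rw [if_pos h]
      split_ifs <;> norm_num
    · have : ∀ y, CountDeviates G (g s) (δ s) (η s) A v (Function.update b u y)
          ↔ CountDeviates G (g s) (δ s) (η s) A v b := fun y => by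
        rw [CountDeviates, sampledCount_update h, CountDeviates]
      simp [this, h]
  have hcq : ∀ u, c u ≤ q := fun u => by
    by_cases hu : u ∈ A
    · refine le_trans ?_ (hhist.2 u hu)
      rw [activeDeg, nbrCount_eq_sum]
      refine (Finset.sum_le_sum fun v hv => ?_).trans
        (Finset.sum_le_sum_of_subset_of_nonneg (Finset.subset_univ K) fun v _ _ => ?_)
      · by_cases h : G.Adj v u
        · simp [h, h.symm, hu, (hKmem v hv).1, ← hA]
        · simp only [h, false_and, if_false]
          split_ifs <;> norm_num
      · split_ifs <;> norm_num
    · simpa [c, hu] using hq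
  have hcsum : ∑ u, c u ≤ 8 * C.card / x s * (2 / x s) := by
    rw [Finset.sum_comm]
    have : ∀ v ∈ K, (∑ u, if G.Adj v u ∧ u ∈ A then (1 : ℝ) else 0) ≤ 2 / x s := fun v hv => by
      rw [← nbrCount_eq_sum]
      exact activeDeg_le hs (hx0 β) hsT (hKmem v hv).1 (hKmem v hv).2.2
    refine (Finset.sum_le_card_nsmul _ _ _ this).trans ?_
    rw [nsmul_eq_mul]
    exact mul_le_mul_of_nonneg_right hKcard (by positivity)
  have hcS : ((Finset.univ : Finset V).toList.map fun u => c u ^ 2).sum ≤ S' := by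
    rw [Finset.sum_map_toList]
    calc ∑ u, c u ^ 2 ≤ ∑ u, q * c u := Finset.sum_le_sum fun u _ => by
          rw [sq]
          exact mul_le_mul_of_nonneg_right (hcq u) (hc0 u)
      _ = q * ∑ u, c u := (Finset.mul_sum _ _ _).symm
      _ ≤ q * (16 * C.card / x s ^ 2) := by
          refine mul_le_mul_of_nonneg_left (hcsum.trans (le_of_eq ?_)) hq
          field_simp
          ring
      _ ≤ S' := hqS
  refine listAvg_upper_tail (fun v => bitProb_mem j (s, v)) Finset.univ.toList
    (fun u _ => hdiff u) hS' ht hcS _ (fun b => by split_ifs <;> norm_num) fun b hb => ?_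
  rw [if_neg]
  rintro ⟨-, -, h⟩
  linarith [hbad b]

end StepProbability

/-! ### The distributed implementation of the process -/

/-- The memory of a node: its coins, the number of the next round in which it is awake, and the
number of sampled active neighbours at each step that it has heard of. -/
structure CoverState where
  coins : ℕ → Bool
  clock : ℕ
  count : ℕ → ℕ

/-- The first step at which a node is sampled. -/
noncomputable def wakeStep (j : ℕ → ℕ) (r : ℕ → Bool) : ℕ := sInf {s | sampleBit j r s = true}

/-- The load estimates computed from `count` stay below `1` before step `s`. -/
def CountsActive (g : ℕ → ℝ) (count : ℕ → ℕ) (s : ℕ) : Prop :=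
  ∀ k < s, ∑ l ∈ Finset.range (k + 1), g l * count l < 1

open Classical in
/-- Every node sleeps until it is sampled for the first time, and stays awake from then on. The
messages of a round list the previous steps at which the sender was both sampled and active. -/
noncomputable def coverAlgorithm (T : ℕ) (j : ℕ → ℕ) (g : ℕ → ℝ) : SleepingAlgorithm where
  State _ := CoverState
  init _ r := ⟨r, 0, 0⟩
  send s _ := some ((List.range s.clock).map fun k =>
    sampleBit j s.coins k && decide (CountsActive g s.count k))
  step s inbox :=
    let count : ℕ → ℕ := fun k =>
      (Finset.univ.filter fun p => ∃ m, inbox p = some m ∧ m[k]? = some true).card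
    if s.clock = 0 then
      (⟨s.coins, max (wakeStep j s.coins) 1, count⟩, some (wakeStep j s.coins - 1))
    else (⟨s.coins, s.clock + 1, count⟩, if s.clock = T + 1 then none else some 0)
  output s := decide (¬ CountsActive g s.count (T + 1))

namespace coverAlgorithm

open Classical SleepingAlgorithm

variable {V : Type*} {T : ℕ} {j : ℕ → ℕ} {g : ℕ → ℝ} {ω : Coins V}

/-- The first step at which `v` is sampled. -/
noncomputable def wake (j : ℕ → ℕ) (ω : Coins V) (v : V) : ℕ := wakeStep j fun k => ω (v, k)

theorem sampleBits_of_lt_wake {v : V} {k : ℕ} (h : k < wake j ω v) :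
    sampleBits j ω (k, v) = false :=
  Bool.eq_false_iff.2 fun hk => Nat.notMem_of_lt_sInf h hk

theorem wake_le_of_sampleBits {v : V} {k : ℕ} (h : sampleBits j ω (k, v) = true) :
    wake j ω v ≤ k := Nat.sInf_le h

theorem wake_le (hT : j T = 0) (v : V) : wake j ω v ≤ T :=
  wake_le_of_sampleBits (by simp [sampleBits, sampleBit, hT])

variable [Fintype V] {G : SimpleGraph V}

theorem mem_activeSet_iff {β : ℕ × V → Bool} {s : ℕ} {v : V} :
    v ∈ activeSet G g β s ↔ ∀ k < s, estLoad G g β (k + 1) v < 1 := by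
  induction s with
  | zero => simp [activeSet_zero]
  | succ s ih =>
    rw [mem_activeSet_succ, ih]
    refine ⟨fun h k hk => ?_, fun h => ⟨fun k hk => h k (by omega), h s s.lt_succ_self⟩⟩
    rcases Nat.lt_succ_iff_lt_or_eq.1 hk with hk | rfl
    exacts [h.1 k hk, h.2]

theorem countsActive_iff {β : ℕ × V → Bool} {s : ℕ} {v : V} {count : ℕ → ℕ}
    (h : ∀ k, k + 1 ≤ s →
      count k = sampledCount G (activeSet G g β k) (fun u => β (k, u)) v) :
    CountsActive g count s ↔ v ∈ activeSet G g β s := by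
  rw [mem_activeSet_iff, CountsActive]
  refine forall₂_congr fun k hk => ?_
  rw [estLoad_eq_sum]
  have : ∑ l ∈ Finset.range (k + 1), g l * (count l : ℝ)
      = ∑ l ∈ Finset.range (k + 1), g l * sampledDeg G g β l v :=
    Finset.sum_congr rfl fun l hl => by
      rw [h l (by have := Finset.mem_range.1 hl; omega)]
      rfl
  rw [this]

variable [DecidableRel G.Adj] {P : PortNumbering G}

theorem card_ports (P : PortNumbering G) (v : V) (Q : V → Prop) :
    (Finset.univ.filter fun p : Fin (G.degree v) => Q (P v p)).card
      = (Finset.univ.filter fun u => G.Adj v u ∧ Q u).card := by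
  refine Finset.card_bij (fun p _ => (P v p : V)) (fun p hp => ?_) (fun p _ q _ h => ?_)
    fun u hu => ?_
  · simp only [Finset.mem_filter, Finset.mem_univ, true_and] at hp ⊢
    exact ⟨(P v p).2, hp⟩
  · exact (P v).injective (Subtype.ext h)
  · simp only [Finset.mem_filter, Finset.mem_univ, true_and] at hu
    refine ⟨(P v).symm ⟨u, hu.1⟩, ?_, ?_⟩ <;> simp [hu.2]

/-- The status of `v` at the beginning of round `t`, for `1 ≤ t ≤ T + 1`. -/
structure IsRunning (P : PortNumbering G) (T : ℕ) (j : ℕ → ℕ) (g : ℕ → ℝ) (ω : Coins V) (t : ℕ)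
    (v : V) (σ : NodeStatus (coverAlgorithm T j g) (G.degree v)) : Prop where
  coins : CoverState.coins σ.state = fun k => ω (v, k)
  asleep : t < wake j ω v → σ.alarm = some (wake j ω v - t) ∧ CoverState.clock σ.state = wake j ω v
  awake : wake j ω v ≤ t → σ.alarm = some 0 ∧ CoverState.clock σ.state = t
  count : wake j ω v < t → ∀ k, k + 1 < t → CoverState.count σ.state k
    = sampledCount G (activeSet G g (sampleBits j ω) k) (fun u => sampleBits j ω (k, u)) v

theorem run_succ_of_awake {t : ℕ} {v : V} (h : ((coverAlgorithm T j g).run P ω t v).alarm = some 0) :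
    (coverAlgorithm T j g).run P ω (t + 1) v
      = ⟨((coverAlgorithm T j g).step ((coverAlgorithm T j g).run P ω t v).state
          ((coverAlgorithm T j g).inbox P ((coverAlgorithm T j g).run P ω t) v)).1,
        ((coverAlgorithm T j g).step ((coverAlgorithm T j g).run P ω t v).state
          ((coverAlgorithm T j g).inbox P ((coverAlgorithm T j g).run P ω t) v)).2⟩ := by
  simp only [SleepingAlgorithm.run, SleepingAlgorithm.round, h]

theorem run_succ_of_asleep {t k : ℕ} {v : V}
    (h : ((coverAlgorithm T j g).run P ω t v).alarm = some (k + 1)) :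
    (coverAlgorithm T j g).run P ω (t + 1) v
      = ⟨((coverAlgorithm T j g).run P ω t v).state, some k⟩ := by
  simp only [SleepingAlgorithm.run, SleepingAlgorithm.round, h]

theorem run_succ_of_halted {t : ℕ} {v : V} (h : ((coverAlgorithm T j g).run P ω t v).alarm = none) :
    (coverAlgorithm T j g).run P ω (t + 1) v = (coverAlgorithm T j g).run P ω t v := by
  simp only [SleepingAlgorithm.run, SleepingAlgorithm.round, h]

theorem isRunning_one (v : V) :
    IsRunning P T j g ω 1 v ((coverAlgorithm T j g).run P ω 1 v) := by
  have h0 : (coverAlgorithm T j g).run P ω 0 v = ⟨⟨fun k => ω (v, k), 0, 0⟩, some 0⟩ := rfl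
  have h1 := run_succ_of_awake (P := P) (T := T) (j := j) (g := g) (ω := ω) (t := 0) (v := v) rfl
  rw [zero_add] at h1
  rw [h1, h0]
  refine ⟨rfl, fun h => ⟨?_, ?_⟩, fun h => ⟨?_, ?_⟩, fun h k hk => by omega⟩
  · rfl
  · exact max_eq_left h.le
  · exact congrArg some (Nat.sub_eq_zero_of_le h)
  · exact max_eq_right h

theorem inbox_getElem {t : ℕ}
    (hrun : ∀ v, IsRunning P T j g ω t v ((coverAlgorithm T j g).run P ω t v)) {k : ℕ} (hk : k < t)
    (v : V) (p : Fin (G.degree v)) :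
    (∃ m, (coverAlgorithm T j g).inbox P ((coverAlgorithm T j g).run P ω t) v p = some m
        ∧ m[k]? = some true)
      ↔ (P v p : V) ∈ activeSet G g (sampleBits j ω) k
        ∧ sampleBits j ω (k, (P v p : V)) = true := by
  set u : V := (P v p : V) with hu
  have hinbox : (coverAlgorithm T j g).inbox P ((coverAlgorithm T j g).run P ω t) v p
      = if ((coverAlgorithm T j g).run P ω t u).alarm = some 0 then
        some ((List.range (CoverState.clock ((coverAlgorithm T j g).run P ω t u).state)).map
          fun k => sampleBit j (CoverState.coins ((coverAlgorithm T j g).run P ω t u).state) k &&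
            decide (CountsActive g
              (CoverState.count ((coverAlgorithm T j g).run P ω t u).state) k))
        else none := rfl
  have hr := hrun u
  rw [hinbox]
  by_cases hw : wake j ω u ≤ t
  · obtain ⟨h1, h2⟩ := hr.awake hw
    rw [if_pos h1, h2, hr.coins]
    have hbit : sampleBit j (fun k => ω (u, k)) k = sampleBits j ω (k, u) := rfl
    simp only [Option.some.injEq, exists_eq_left', List.getElem?_map, List.getElem?_range hk,
      Option.map_some, hbit, Bool.and_eq_true, decide_eq_true_eq]
    rw [and_comm]
    refine and_congr_left fun hb => ?_
    have hwk := wake_le_of_sampleBits hb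
    exact countsActive_iff fun l hl => hr.count (by omega) l (by omega)
  · push Not at hw
    obtain ⟨h1, -⟩ := hr.asleep hw
    have hne : ((coverAlgorithm T j g).run P ω t u).alarm ≠ some 0 := by
      rw [h1]
      simp only [ne_eq, Option.some.injEq]
      omega
    rw [if_neg hne]
    simp [sampleBits_of_lt_wake (ω := ω) (hk.trans hw)]

theorem count_step {t : ℕ}
    (hrun : ∀ v, IsRunning P T j g ω t v ((coverAlgorithm T j g).run P ω t v)) {k : ℕ} (hk : k < t)
    (v : V) :
    (Finset.univ.filter fun p => ∃ m,
      (coverAlgorithm T j g).inbox P ((coverAlgorithm T j g).run P ω t) v p = some m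
        ∧ m[k]? = some true).card
      = sampledCount G (activeSet G g (sampleBits j ω) k) (fun u => sampleBits j ω (k, u)) v := by
  simp only [inbox_getElem hrun hk]
  convert card_ports P v fun u =>
    u ∈ activeSet G g (sampleBits j ω) k ∧ sampleBits j ω (k, u) = true using 1
  · congr!
  · unfold sampledCount
    congr!

theorem run_succ_of_clock {t : ℕ} (ht : 1 ≤ t) {v : V}
    (h : ((coverAlgorithm T j g).run P ω t v).alarm = some 0)
    (hc : CoverState.clock ((coverAlgorithm T j g).run P ω t v).state = t) :
    (coverAlgorithm T j g).run P ω (t + 1) v = NodeStatus.mk (A := coverAlgorithm T j g)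
      (CoverState.mk (CoverState.coins ((coverAlgorithm T j g).run P ω t v).state) (t + 1)
        fun k => (Finset.univ.filter fun p => ∃ m,
          (coverAlgorithm T j g).inbox P ((coverAlgorithm T j g).run P ω t) v p = some m
            ∧ m[k]? = some true).card)
      (if t = T + 1 then none else some 0) := by
  have hstep : (coverAlgorithm T j g).step ((coverAlgorithm T j g).run P ω t v).state
      ((coverAlgorithm T j g).inbox P ((coverAlgorithm T j g).run P ω t) v)
      = (CoverState.mk (CoverState.coins ((coverAlgorithm T j g).run P ω t v).state)
        (CoverState.clock ((coverAlgorithm T j g).run P ω t v).state + 1)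
        fun k => (Finset.univ.filter fun p => ∃ m,
          (coverAlgorithm T j g).inbox P ((coverAlgorithm T j g).run P ω t) v p = some m
            ∧ m[k]? = some true).card,
        if CoverState.clock ((coverAlgorithm T j g).run P ω t v).state = T + 1 then none
        else some 0) := if_neg (by omega)
  rw [hc] at hstep
  exact (run_succ_of_awake h).trans (congrArg (fun r : CoverState × Option ℕ =>
    NodeStatus.mk (A := coverAlgorithm T j g) (d := G.degree v) r.1 r.2) hstep)

theorem isRunning {t : ℕ} (ht : 1 ≤ t) (htT : t ≤ T + 1) (v : V) :
    IsRunning P T j g ω t v ((coverAlgorithm T j g).run P ω t v) := by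
  induction t, ht using Nat.le_induction generalizing v with
  | base => exact isRunning_one v
  | succ t ht ih =>
    have hrun := fun v => ih (by omega) v
    have hr := hrun v
    by_cases hw : wake j ω v ≤ t
    · obtain ⟨h1, h2⟩ := hr.awake hw
      rw [run_succ_of_clock ht h1 h2]
      refine ⟨hr.coins, fun h => by omega, fun _ => ⟨if_neg (by omega), rfl⟩,
        fun _ k hk => count_step hrun (by omega) v⟩
    · push Not at hw
      obtain ⟨h1, h2⟩ := hr.asleep hw
      rw [run_succ_of_asleep (k := wake j ω v - (t + 1)) (by rw [h1]; congr 1; omega)]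
      refine ⟨hr.coins, fun h => ⟨rfl, h2⟩, fun h => ⟨?_, ?_⟩, fun h => by omega⟩
      · exact congrArg some (by omega)
      · exact h2.trans (by omega)

theorem halted (hT : j T = 0) {t : ℕ} (ht : T + 2 ≤ t) (v : V) :
    ((coverAlgorithm T j g).run P ω t v).alarm = none ∧ ∀ k < T + 1,
      CoverState.count ((coverAlgorithm T j g).run P ω t v).state k
        = sampledCount G (activeSet G g (sampleBits j ω) k) (fun u => sampleBits j ω (k, u)) v := by
  induction t, ht using Nat.le_induction with
  | base =>
    have hrun := fun v => isRunning (P := P) (T := T) (j := j) (g := g) (ω := ω)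
      (show 1 ≤ T + 1 by omega) le_rfl v
    have hw := wake_le (ω := ω) hT v
    obtain ⟨h1, h2⟩ := (hrun v).awake (by omega)
    rw [run_succ_of_clock (by omega) h1 h2]
    exact ⟨if_pos rfl, fun k hk => count_step hrun hk v⟩
  | succ t ht ih =>
    rw [run_succ_of_halted ih.1]
    exact ih

theorem hasHalted (hT : j T = 0) (v : V) : (coverAlgorithm T j g).HasHalted P ω (T + 2) v :=
  (halted hT le_rfl v).1

theorem isAwake_imp (hT : j T = 0) {t : ℕ} {v : V} (h : (coverAlgorithm T j g).IsAwake P ω t v) :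
    t = 0 ∨ wake j ω v ≤ t ∧ t ≤ T + 1 := by
  by_contra hcon
  push Not at hcon
  have ht : t ≤ T + 1 := by
    by_contra hlt
    have := (halted (P := P) (g := g) (ω := ω) hT (show T + 2 ≤ t by omega) v).1
    rw [IsAwake, this] at h
    simp at h
  have hr := isRunning (P := P) (j := j) (g := g) (ω := ω) (show 1 ≤ t by omega) ht v
  have hw : t < wake j ω v := by
    by_contra hlt
    have := hcon.2 (by omega)
    omega
  rw [IsAwake, (hr.asleep hw).1] at h
  simp only [Option.some.injEq] at h
  omega

theorem awakeComplexity_le (hT : j T = 0) (v : V) :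
    (coverAlgorithm T j g).awakeComplexity P ω v ≤ ((T + 3 - wake j ω v : ℕ) : ℕ∞) := by
  have hsub : {t : ℕ | (coverAlgorithm T j g).IsAwake P ω t v}
      ⊆ (insert 0 (Finset.Icc (wake j ω v) (T + 1)) : Finset ℕ) := fun t ht => by
    rw [Finset.mem_coe, Finset.mem_insert, Finset.mem_Icc]
    exact isAwake_imp hT ht
  refine (Set.encard_le_encard hsub).trans ?_
  rw [Set.encard_coe_eq_coe_finsetCard]
  refine Nat.cast_le.2 ((Finset.card_insert_le _ _).trans ?_)
  have := wake_le (ω := ω) hT v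
  rw [Nat.card_Icc]
  omega

theorem messageBitsLE (hT : j T = 0) {b : ℝ} (hb : ∀ v : V, G.degree v ≠ 0 → (T + 1 : ℝ) ≤ b) :
    (coverAlgorithm T j g).MessageBitsLE P ω b := by
  intro t v p m hawake hm
  have hlen : m.length = CoverState.clock ((coverAlgorithm T j g).run P ω t v).state := by
    have := Option.some.inj hm
    rw [← this, List.length_map, List.length_range]
  have hclock : CoverState.clock ((coverAlgorithm T j g).run P ω t v).state ≤ T + 1 := by
    rcases Nat.eq_zero_or_pos t with rfl | ht
    · exact Nat.zero_le _
    · rcases isAwake_imp hT hawake with h | ⟨h1, h2⟩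
      · omega
      · rw [((isRunning (P := P) (j := j) (g := g) (ω := ω) ht h2 v).awake h1).2]
        exact h2
  rw [hlen]
  refine le_trans ?_ (hb v fun h0 => ?_)
  · exact_mod_cast hclock
  · exact absurd p.2 (by omega)

theorem outputSet_eq (hT : j T = 0) :
    (coverAlgorithm T j g).outputSet P ω
      = ((activeSet G g (sampleBits j ω) (T + 1))ᶜ : Finset V) := by
  ext v
  have hout : ∀ t, T + 2 ≤ t → ((coverAlgorithm T j g).output
      ((coverAlgorithm T j g).run P ω t v).state = true
        ↔ v ∉ activeSet G g (sampleBits j ω) (T + 1)) := fun t ht => by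
    rw [← countsActive_iff fun k hk => (halted (P := P) hT ht v).2 k (by omega)]
    exact decide_eq_true_iff
  rw [Finset.mem_coe, Finset.mem_compl]
  constructor
  · rintro ⟨t, hh, ho⟩
    refine (hout t ?_).1 ho
    by_contra hlt
    rw [HasHalted] at hh
    rcases Nat.eq_zero_or_pos t with rfl | ht
    · exact absurd hh (by simp [SleepingAlgorithm.run])
    · have hr := isRunning (P := P) (T := T) (j := j) (g := g) (ω := ω) ht (by omega) v
      rcases le_or_gt (wake j ω v) t with h | h
      · rw [(hr.awake h).1] at hh
        simp at hh
      · rw [(hr.asleep h).1] at hh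
        simp at hh
  · exact fun h => ⟨T + 2, hasHalted hT v, (hout _ le_rfl).2 h⟩

theorem isVertexCover_outputSet {R : ℕ} (hj : ∀ s, R ≤ s → j s = 0) (hRT : R ≤ T)
    (hg : ∀ s, 0 ≤ g s) (hgsum : 1 ≤ ∑ k ∈ (Finset.range (T + 1)).filter (R ≤ ·), g k) :
    G.IsVertexCover ((coverAlgorithm T j g).outputSet P ω) := by
  rw [outputSet_eq (hj T hRT)]
  intro u v hadj
  rw [Finset.mem_coe, Finset.mem_coe, Finset.mem_compl, Finset.mem_compl]
  by_contra hcon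
  push Not at hcon
  have hu := (mem_activeSet_succ.1 hcon.1).2
  rw [estLoad_eq_sum] at hu
  refine absurd hu (not_lt.2 (hgsum.trans ?_))
  have hsd : ∀ k, 0 ≤ sampledDeg G g (sampleBits j ω) k u := fun k => Nat.cast_nonneg _
  calc ∑ k ∈ (Finset.range (T + 1)).filter (R ≤ ·), g k
      ≤ ∑ k ∈ (Finset.range (T + 1)).filter (R ≤ ·),
          g k * sampledDeg G g (sampleBits j ω) k u := by
        refine Finset.sum_le_sum fun k hk => le_mul_of_one_le_right (hg k) ?_
        rw [Finset.mem_filter, Finset.mem_range] at hk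
        refine Nat.one_le_cast.2 (Finset.card_pos.2 ⟨v, ?_⟩)
        simp only [Finset.mem_filter, Finset.mem_univ, true_and]
        exact ⟨hadj, activeSet_antitone (by omega) hcon.2, by
          simp [sampleBits, sampleBit, hj k hk.2]⟩
    _ ≤ _ := Finset.sum_le_sum_of_subset_of_nonneg (Finset.filter_subset _ _)
        fun k _ _ => mul_nonneg (hg k) (hsd k)

end coverAlgorithm

/-! ### The parameters -/

namespace CoverParams

/-- Edge weights grow by the factor `growth ε ^ 8` in each step. -/
noncomputable def growth (ε : ℝ) : ℝ := 1 + ε / 8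

/-- The number of steps in which the sampling probability stays constant. -/
noncomputable def phaseLen (ε : ℝ) : ℕ := ⌈8 / ε⌉₊

/-- The number of final steps without sampling. -/
noncomputable def exactLen (ε : ℝ) : ℕ := ⌈64 / ε ^ 3⌉₊

/-- The last step. -/
noncomputable def lastStep (ε : ℝ) (D : ℕ) : ℕ := ⌈1 / ε⌉₊ * Nat.clog 2 (2 * D)

/-- The first step without sampling. -/
noncomputable def exactStep (ε : ℝ) (D : ℕ) : ℕ := lastStep ε D - exactLen ε

/-- The sampling probability of step `s` is `2 ^ (- sampleExp ε D s)`. -/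
noncomputable def sampleExp (ε : ℝ) (D s : ℕ) : ℕ := (exactStep ε D - s) / phaseLen ε

/-- The weight at step `s` of an edge between active nodes. -/
noncomputable def weight (ε : ℝ) (D s : ℕ) : ℝ := 2 / growth ε ^ (8 * (lastStep ε D - s))

/-- The increment of the edge weight at step `s`. -/
noncomputable def increment (ε : ℝ) (D : ℕ) : ℕ → ℝ
  | 0 => weight ε D 0
  | s + 1 => weight ε D (s + 1) - weight ε D s

/-- The increment of the edge weight divided by the sampling probability. -/
noncomputable def scaledIncrement (ε : ℝ) (D s : ℕ) : ℝ := increment ε D s * 2 ^ sampleExp ε D s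

/-- The tolerated deviation of the estimates in step `s`. -/
noncomputable def tolerance (ε : ℝ) (D s : ℕ) : ℝ :=
  if s < exactStep ε D then 1 / growth ε ^ (lastStep ε D - s) else 0

variable {ε : ℝ} {D : ℕ}

theorem one_le_growth (h0 : 0 < ε) : 1 ≤ growth ε := by unfold growth; linarith

theorem one_le_growth_pow (h0 : 0 < ε) (n : ℕ) : 1 ≤ growth ε ^ n := one_le_pow₀ (one_le_growth h0)

theorem growth_pow_pos (h0 : 0 < ε) (n : ℕ) : 0 < growth ε ^ n :=
  pow_pos (by linarith [one_le_growth h0]) n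

theorem one_add_mul_le_growth_pow (h0 : 0 < ε) (n : ℕ) : 1 + n * (ε / 8) ≤ growth ε ^ n :=
  one_add_mul_le_pow (by linarith) n

theorem phaseLen_pos (h0 : 0 < ε) : 0 < phaseLen ε := Nat.ceil_pos.2 (by positivity)

theorem two_le_growth_pow_phaseLen (h0 : 0 < ε) : 2 ≤ growth ε ^ phaseLen ε := by
  have h1 : 8 / ε ≤ phaseLen ε := Nat.le_ceil _
  have h2 : 8 / ε * (ε / 8) ≤ phaseLen ε * (ε / 8) :=
    mul_le_mul_of_nonneg_right h1 (by linarith)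
  have h3 : 8 / ε * (ε / 8) = 1 := by field_simp
  linarith [one_add_mul_le_growth_pow h0 (phaseLen ε)]

theorem le_growth_pow_exactLen (h0 : 0 < ε) : 8 / ε ^ 2 ≤ growth ε ^ exactLen ε := by
  have h1 : 64 / ε ^ 3 ≤ exactLen ε := Nat.le_ceil _
  have h2 : 64 / ε ^ 3 * (ε / 8) ≤ exactLen ε * (ε / 8) :=
    mul_le_mul_of_nonneg_right h1 (by linarith)
  have h3 : 64 / ε ^ 3 * (ε / 8) = 8 / ε ^ 2 := by field_simp; norm_num
  linarith [one_add_mul_le_growth_pow h0 (exactLen ε)]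

theorem large_le_growth_pow_exactLen (h0 : 0 < ε) (h1 : ε ≤ 1 / 1000) :
    8000000 ≤ growth ε ^ exactLen ε := by
  refine le_trans ?_ (le_growth_pow_exactLen h0)
  rw [le_div_iff₀ (by positivity)]
  nlinarith

theorem growth_pow_eight_le (h0 : 0 < ε) (h1 : ε ≤ 1 / 1000) : growth ε ^ 8 ≤ 1 + 2 * ε := by
  have h2 : growth ε ≤ Real.exp (ε / 8) := by
    have := Real.add_one_le_exp (ε / 8)
    unfold growth
    linarith
  have h3 : growth ε ^ 8 ≤ Real.exp ε := by
    refine (pow_le_pow_left₀ (by linarith [one_le_growth h0]) h2 8).trans (le_of_eq ?_)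
    rw [← Real.exp_nat_mul]
    congr 1
    push_cast
    ring
  have h4 := (abs_le.1 (Real.abs_exp_sub_one_sub_id_le (x := ε)
    (by rw [abs_of_pos h0]; linarith))).2
  nlinarith

theorem two_pow_sampleExp_le (h0 : 0 < ε) (s : ℕ) :
    (2 : ℝ) ^ sampleExp ε D s ≤ growth ε ^ (lastStep ε D - s) := by
  calc (2 : ℝ) ^ sampleExp ε D s ≤ (growth ε ^ phaseLen ε) ^ sampleExp ε D s :=
        pow_le_pow_left₀ (by norm_num) (two_le_growth_pow_phaseLen h0) _
    _ = growth ε ^ (phaseLen ε * sampleExp ε D s) := (pow_mul _ _ _).symm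
    _ ≤ growth ε ^ (lastStep ε D - s) := by
        refine pow_le_pow_right₀ (one_le_growth h0) ((Nat.mul_div_le _ _).trans ?_)
        unfold exactStep
        omega

theorem sampleExp_eq_zero {s : ℕ} (h : exactStep ε D ≤ s) : sampleExp ε D s = 0 := by
  rw [sampleExp, Nat.sub_eq_zero_of_le h, Nat.zero_div]

theorem exactStep_le : exactStep ε D ≤ lastStep ε D := Nat.sub_le _ _

theorem lastStep_sub (h : 0 < exactStep ε D) : lastStep ε D - exactStep ε D = exactLen ε := by
  unfold exactStep at *
  omega

theorem weight_pos (h0 : 0 < ε) (s : ℕ) : 0 < weight ε D s :=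
  div_pos two_pos (growth_pow_pos h0 _)

theorem weight_le_two (h0 : 0 < ε) (s : ℕ) : weight ε D s ≤ 2 :=
  div_le_self zero_le_two (one_le_growth_pow h0 _)

theorem weight_mono (h0 : 0 < ε) : Monotone (weight ε D) := fun a b h =>
  div_le_div_of_nonneg_left zero_le_two (growth_pow_pos h0 _)
    (pow_le_pow_right₀ (one_le_growth h0) (by omega))

theorem weight_eq_sum (s : ℕ) :
    weight ε D s = ∑ k ∈ Finset.range (s + 1), increment ε D k := by
  induction s with
  | zero => simp [increment]
  | succ s ih => rw [Finset.sum_range_succ, ← ih, increment]; ring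

theorem increment_nonneg (h0 : 0 < ε) : ∀ s, 0 ≤ increment ε D s
  | 0 => (weight_pos h0 0).le
  | s + 1 => sub_nonneg.2 (weight_mono h0 s.le_succ)

theorem increment_le_weight (h0 : 0 < ε) : ∀ s, increment ε D s ≤ weight ε D s
  | 0 => le_rfl
  | s + 1 => sub_le_self _ (weight_pos h0 s).le

theorem weight_succ_le (h0 : 0 < ε) (s : ℕ) :
    weight ε D (s + 1) ≤ growth ε ^ 8 * weight ε D s := by
  have hp := growth_pow_pos h0 (8 * (lastStep ε D - (s + 1)))
  by_cases h : s < lastStep ε D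
  · have : 8 * (lastStep ε D - s) = 8 + 8 * (lastStep ε D - (s + 1)) := by omega
    rw [weight, weight, this, pow_add]
    have hg : growth ε ≠ 0 := by linarith [one_le_growth h0]
    refine le_of_eq ?_
    field_simp
  · have : lastStep ε D - (s + 1) = lastStep ε D - s := by omega
    rw [weight, this, ← weight]
    exact le_mul_of_one_le_left (weight_pos h0 s).le (one_le_growth_pow h0 8)

theorem sum_inv_growth_pow_le (h0 : 0 < ε) {n : ℕ} (hn : n ≤ lastStep ε D) :
    ∑ k ∈ Finset.range n, 1 / growth ε ^ (lastStep ε D - k)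
      ≤ 8 / ε / growth ε ^ (lastStep ε D - n) := by
  induction n with
  | zero =>
    have := growth_pow_pos h0 (lastStep ε D - 0)
    simp only [Finset.range_zero, Finset.sum_empty]
    positivity
  | succ n ih =>
    rw [Finset.sum_range_succ]
    refine (add_le_add (ih (by omega)) le_rfl).trans (le_of_eq ?_)
    have h1 : lastStep ε D - n = lastStep ε D - (n + 1) + 1 := by omega
    have hp := growth_pow_pos h0 (lastStep ε D - (n + 1))
    rw [h1, pow_succ]
    have hg : growth ε ≠ 0 := by linarith [one_le_growth h0]
    have hg' : growth ε = 1 + ε / 8 := rfl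
    field_simp
    rw [hg']
    ring

theorem sum_inv_growth_pow_le_eps (h0 : 0 < ε) :
    ∑ k ∈ Finset.range (exactStep ε D), 1 / growth ε ^ (lastStep ε D - k) ≤ ε := by
  rcases Nat.eq_zero_or_pos (exactStep ε D) with h | h
  · rw [h]
    simpa using h0.le
  · refine (sum_inv_growth_pow_le h0 exactStep_le).trans ?_
    rw [lastStep_sub h, div_le_iff₀ (growth_pow_pos h0 _)]
    have := mul_le_mul_of_nonneg_left (le_growth_pow_exactLen h0) h0.le
    refine le_trans (le_of_eq ?_) this
    field_simp

theorem sum_tolerance_le (h0 : 0 < ε) :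
    ∑ k ∈ Finset.range (lastStep ε D + 1), tolerance ε D k ≤ ε := by
  refine le_trans (le_of_eq ?_) (sum_inv_growth_pow_le_eps (D := D) h0)
  simp only [tolerance]
  rw [← Finset.sum_filter]
  congr 1
  ext k
  have := exactStep_le (ε := ε) (D := D)
  simp only [Finset.mem_filter, Finset.mem_range]
  omega

theorem isSchedule (h0 : 0 < ε) (h1 : ε ≤ 1 / 1000) (D : ℕ) :
    IsSchedule ε (growth ε ^ 8) (lastStep ε D) (increment ε D) (weight ε D) (tolerance ε D) where
  eps_pos := h0
  eps_le := h1
  gamma_ge := one_le_growth_pow h0 8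
  gamma_le := growth_pow_eight_le h0 h1
  delta_nonneg := increment_nonneg h0
  x_eq := weight_eq_sum
  x_pos := weight_pos h0
  x_le := weight_le_two h0
  x_succ := weight_succ_le h0
  eta_nonneg s := by
    unfold tolerance
    split_ifs
    exacts [(div_pos one_pos (growth_pow_pos h0 _)).le, le_rfl]
  eta_sum := sum_tolerance_le h0

theorem two_mul_le_growth_pow (h0 : 0 < ε) : (2 * D : ℝ) ≤ growth ε ^ (8 * lastStep ε D) := by
  have h1 : 1 + ε ≤ growth ε ^ 8 := by
    have := one_add_mul_le_growth_pow h0 8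
    push_cast at this
    linarith
  have h2 : 2 ≤ (growth ε ^ 8) ^ ⌈1 / ε⌉₊ := by
    have h3 : 1 / ε ≤ ⌈1 / ε⌉₊ := Nat.le_ceil _
    have h4 : 1 / ε * ε ≤ ⌈1 / ε⌉₊ * ε := mul_le_mul_of_nonneg_right h3 h0.le
    rw [one_div_mul_cancel h0.ne'] at h4
    have h5 : 1 + ⌈1 / ε⌉₊ * ε ≤ (1 + ε) ^ ⌈1 / ε⌉₊ := one_add_mul_le_pow (by linarith) _
    have h6 := pow_le_pow_left₀ (by linarith) h1 ⌈1 / ε⌉₊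
    linarith
  rw [pow_mul, lastStep, pow_mul]
  calc (2 * D : ℝ) ≤ 2 ^ Nat.clog 2 (2 * D) := by
        exact_mod_cast Nat.le_pow_clog (by norm_num) (2 * D)
    _ ≤ _ := pow_le_pow_left₀ (by norm_num) h2 _

theorem scaledIncrement_nonneg (h0 : 0 < ε) (s : ℕ) : 0 ≤ scaledIncrement ε D s :=
  mul_nonneg (increment_nonneg h0 s) (by positivity)

theorem scaledIncrement_mul (s : ℕ) :
    scaledIncrement ε D s * (1 / 2) ^ sampleExp ε D s = increment ε D s := by
  rw [scaledIncrement, mul_assoc, ← mul_pow]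
  norm_num

theorem scaledIncrement_le (h0 : 0 < ε) (s : ℕ) :
    2 / weight ε D s * scaledIncrement ε D s ^ 2
      ≤ 4 / growth ε ^ (6 * (lastStep ε D - s)) := by
  set r := lastStep ε D - s
  have hg := growth_pow_pos h0 r
  have h1 : scaledIncrement ε D s ≤ weight ε D s * growth ε ^ r :=
    mul_le_mul (increment_le_weight h0 s) (two_pow_sampleExp_le h0 s) (by positivity)
      (weight_pos h0 s).le
  have hw : weight ε D s = 2 / (growth ε ^ r) ^ 8 := by rw [weight, ← pow_mul, mul_comm]
  have h2 := pow_le_pow_left₀ (scaledIncrement_nonneg h0 s) h1 2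
  refine (mul_le_mul_of_nonneg_left h2 (div_pos two_pos (weight_pos h0 s)).le).trans
    (le_of_eq ?_)
  rw [hw, mul_comm 6, pow_mul]
  field_simp
  norm_num

theorem one_le_sum_scaledIncrement (h0 : 0 < ε) (h1 : ε ≤ 1 / 1000) :
    1 ≤ ∑ k ∈ (Finset.range (lastStep ε D + 1)).filter (exactStep ε D ≤ ·),
      scaledIncrement ε D k := by
  have hle := exactStep_le (ε := ε) (D := D)
  have h2 : ∑ k ∈ (Finset.range (lastStep ε D + 1)).filter (exactStep ε D ≤ ·),
      scaledIncrement ε D k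
      = ∑ k ∈ (Finset.range (lastStep ε D + 1)).filter (exactStep ε D ≤ ·), increment ε D k :=
    Finset.sum_congr rfl fun k hk => by
      rw [scaledIncrement, sampleExp_eq_zero (Finset.mem_filter.1 hk).2, pow_zero, mul_one]
  have h3 : ∑ k ∈ Finset.range (exactStep ε D), increment ε D k ≤ 1 := by
    rcases Nat.eq_zero_or_pos (exactStep ε D) with h | h
    · simp [h]
    · obtain ⟨r, hr⟩ : ∃ r, exactStep ε D = r + 1 := ⟨exactStep ε D - 1, by omega⟩
      rw [hr, ← weight_eq_sum, weight, div_le_one (growth_pow_pos h0 _)]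
      have hsub := lastStep_sub h
      refine le_trans ?_ (pow_le_pow_right₀ (one_le_growth h0)
        (show exactLen ε ≤ 8 * (lastStep ε D - r) by omega))
      linarith [large_le_growth_pow_exactLen h0 h1]
  have h4 : ∑ k ∈ Finset.range (lastStep ε D + 1), increment ε D k = 2 := by
    rw [← weight_eq_sum, weight, Nat.sub_self, mul_zero, pow_zero, div_one]
  have h5 := Finset.sum_filter_add_sum_filter_not (Finset.range (lastStep ε D + 1))
    (exactStep ε D ≤ ·) (increment ε D)
  have h6 : (Finset.range (lastStep ε D + 1)).filter (fun k => ¬ exactStep ε D ≤ k)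
      = Finset.range (exactStep ε D) := by
    ext k
    simp only [Finset.mem_filter, Finset.mem_range]
    omega
  rw [h6, h4] at h5
  rw [h2]
  linarith

/-! ### Bounds on the number of steps -/

theorem clog_two_le {X : ℕ} (hX : 2 ≤ X) : (Nat.clog 2 X : ℝ) ≤ 3 * Real.log X := by
  have h1 : Nat.clog 2 X ≤ Nat.log 2 X + 1 :=
    Nat.clog_le_of_le_pow (Nat.lt_pow_succ_log_self (by norm_num) X).le
  have h2 : (Nat.log 2 X : ℝ) * Real.log 2 ≤ Real.log X := by
    rw [← Real.log_pow]
    refine Real.log_le_log (by positivity) ?_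
    exact_mod_cast Nat.pow_log_le_self 2 (by omega)
  have h3 : Real.log 2 ≤ Real.log X := Real.log_le_log (by norm_num) (by exact_mod_cast hX)
  have h4 := Real.log_two_gt_d9
  have h5 : (Nat.clog 2 X : ℝ) ≤ Nat.log 2 X + 1 := by exact_mod_cast h1
  have h6 : (Nat.log 2 X : ℝ) ≥ 0 := Nat.cast_nonneg _
  nlinarith

theorem clog_degree_le {c X : ℕ} (hX : 2 ≤ X) (hD : D ≤ X ^ c) :
    (Nat.clog 2 (2 * D) : ℝ) ≤ 3 * (c + 1) * Real.log X := by
  have h1 : Nat.clog 2 (2 * D) ≤ 1 + c * Nat.clog 2 X := by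
    refine Nat.clog_le_of_le_pow ?_
    rw [pow_add, pow_one, mul_comm c, pow_mul]
    exact Nat.mul_le_mul_left 2 (hD.trans (Nat.pow_le_pow_left
      (Nat.le_pow_clog (by norm_num) X) c))
  have h2 : (Nat.clog 2 (2 * D) : ℝ) ≤ 1 + c * Nat.clog 2 X := by exact_mod_cast h1
  have h3 := mul_le_mul_of_nonneg_left (clog_two_le hX) (Nat.cast_nonneg (α := ℝ) c)
  have h4 : Real.log 2 ≤ Real.log X := Real.log_le_log (by norm_num) (by exact_mod_cast hX)
  have h5 := Real.log_two_gt_d9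
  nlinarith

theorem ceil_inv_le (h0 : 0 < ε) (h1 : ε ≤ 1 / 1000) : (⌈1 / ε⌉₊ : ℝ) ≤ 2 / ε := by
  have h2 := (Nat.ceil_lt_add_one (show 0 ≤ 1 / ε by positivity)).le
  have h3 : 1 ≤ 1 / ε := by rw [le_div_iff₀ h0]; linarith
  have h4 : 2 / ε = 1 / ε + 1 / ε := by ring
  linarith

theorem lastStep_le_sq (h0 : 0 < ε) (h1 : ε ≤ 1 / 1000) (h : 0 < exactStep ε D) :
    (lastStep ε D : ℝ) ≤ (Nat.clog 2 (2 * D) : ℝ) ^ 2 := by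
  set lam : ℝ := (Nat.clog 2 (2 * D) : ℝ) with hlam
  have hT : (lastStep ε D : ℝ) = ⌈1 / ε⌉₊ * lam := by rw [lastStep, Nat.cast_mul]
  have hlam0 : 0 ≤ lam := Nat.cast_nonneg _
  have h2 : (lastStep ε D : ℝ) ≤ 2 / ε * lam :=
    hT.trans_le (mul_le_mul_of_nonneg_right (ceil_inv_le h0 h1) hlam0)
  have h3 : 64 / ε ^ 3 ≤ lastStep ε D := by
    refine (Nat.le_ceil _).trans ?_
    have : exactLen ε ≤ lastStep ε D := by unfold exactStep at h; omega
    exact_mod_cast this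
  have h4 : 2 / ε ≤ lam := by
    have h5 : 64 / ε ^ 3 ≤ 2 / ε * lam := h3.trans h2
    have h6 : 64 / ε ^ 3 = 2 / ε * (32 / ε ^ 2) := by field_simp; norm_num
    rw [h6] at h5
    have h7 := le_of_mul_le_mul_left h5 (by positivity)
    refine le_trans ?_ h7
    rw [div_le_div_iff₀ h0 (by positivity)]
    nlinarith
  rw [sq]
  exact h2.trans (mul_le_mul_of_nonneg_right h4 hlam0)

end CoverParams

/-! ### Probability bounds -/

section Probability

open Classical CoverParams

variable {V : Type*} [Fintype V] {G : SimpleGraph V} {ε : ℝ} {D : ℕ}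

/-- The nodes whose first deviation occurs at step `s`, with the parameters of the algorithm. -/
noncomputable def coverBad (G : SimpleGraph V) (ε : ℝ) (D : ℕ) (β : ℕ × V → Bool) (s : ℕ) :
    Finset V :=
  badSet G (scaledIncrement ε D) (increment ε D) (tolerance ε D) β s

/-- Too many nodes deviate at step `s`. While the weights are small, no node may deviate. -/
def UnusualStep (G : SimpleGraph V) (C : Finset V) (ε : ℝ) (D : ℕ) (ℓ : ℝ) (s : ℕ)
    (β : ℕ × V → Bool) : Prop :=
  if ℓ ≤ growth ε ^ (4 * (lastStep ε D - s)) then (coverBad G ε D β s).Nonempty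
  else (∑ k ∈ Finset.range s, ((coverBad G ε D β k).card : ℝ) / weight ε D k ≤ C.card) ∧
    (∀ u ∈ activeSet G (scaledIncrement ε D) β s,
      activeDeg G (scaledIncrement ε D) β s u ≤ ℓ ^ 2) ∧
    2 * C.card / growth ε ^ (9 * (lastStep ε D - s)) < (coverBad G ε D β s).card

theorem weight_zero_mul_le (h0 : 0 < ε) (hdeg : ∀ v, nbrCount G Finset.univ v ≤ D)
    (β : ℕ × V → Bool) (v : V) :
    weight ε D 0 * activeDeg G (scaledIncrement ε D) β 0 v ≤ 1 := by
  have h1 : activeDeg G (scaledIncrement ε D) β 0 v ≤ D := Nat.cast_le.2 (hdeg v)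
  have h2 := two_mul_le_growth_pow (D := D) h0
  rw [weight, Nat.sub_zero, div_mul_eq_mul_div, div_le_one (growth_pow_pos h0 _)]
  linarith

theorem card_coverBad_div_le (h0 : 0 < ε) (h1 : ε ≤ 1 / 1000)
    (hdeg : ∀ v, nbrCount G Finset.univ v ≤ D) {C : Finset V} {ℓ : ℝ} {β : ℕ × V → Bool}
    (h : ∀ s < exactStep ε D, ¬ UnusualStep G C ε D ℓ s β) {s : ℕ} (hs : s < exactStep ε D) :
    ((coverBad G ε D β s).card : ℝ) / weight ε D s
      ≤ C.card * (1 / growth ε ^ (lastStep ε D - s)) := by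
  induction s using Nat.strong_induction_on with
  | _ s ih =>
  have hRT := exactStep_le (ε := ε) (D := D)
  have hu := h s hs
  unfold UnusualStep at hu
  have hz := growth_pow_pos h0 (lastStep ε D - s)
  by_cases hl : ℓ ≤ growth ε ^ (4 * (lastStep ε D - s))
  · rw [if_pos hl, Finset.not_nonempty_iff_eq_empty] at hu
    rw [hu, Finset.card_empty, Nat.cast_zero, zero_div]
    positivity
  · rw [if_neg hl] at hu
    have hsum : ∑ k ∈ Finset.range s, ((coverBad G ε D β k).card : ℝ) / weight ε D k ≤ C.card := by
      calc _ ≤ ∑ k ∈ Finset.range s, C.card * (1 / growth ε ^ (lastStep ε D - k)) :=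
            Finset.sum_le_sum fun k hk => by
              have := Finset.mem_range.1 hk
              exact ih k this (by omega)
        _ ≤ ∑ k ∈ Finset.range (exactStep ε D), C.card * (1 / growth ε ^ (lastStep ε D - k)) :=
            Finset.sum_le_sum_of_subset_of_nonneg (Finset.range_mono hs.le) fun k _ _ => by
              have := growth_pow_pos h0 (lastStep ε D - k)
              positivity
        _ ≤ C.card * 1 := by
            rw [← Finset.mul_sum]
            exact mul_le_mul_of_nonneg_left
              ((sum_inv_growth_pow_le_eps h0).trans (by linarith)) (Nat.cast_nonneg _)
        _ = C.card := mul_one _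
    have hd : ∀ u ∈ activeSet G (scaledIncrement ε D) β s,
        activeDeg G (scaledIncrement ε D) β s u ≤ ℓ ^ 2 := by
      intro u hu'
      have hex : ∃ k, ¬ ℓ ≤ growth ε ^ (4 * (lastStep ε D - k)) := ⟨s, hl⟩
      have hk := Nat.find_spec hex
      have hks : Nat.find hex ≤ s := Nat.find_le hl
      have hmin : ∀ i < Nat.find hex, ℓ ≤ growth ε ^ (4 * (lastStep ε D - i)) :=
        fun i hi => not_not.1 (Nat.find_min hex hi)
      generalize Nat.find hex = k at hk hks hmin
      have hacc : Accurate G (scaledIncrement ε D) (increment ε D) (tolerance ε D) β k u :=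
        accurate_of_notMem_badSet fun i hi =>
          ⟨activeSet_antitone (by omega) hu', fun hmem => by
            have := h i (by omega)
            rw [UnusualStep, if_pos (hmin i hi)] at this
            exact this ⟨u, hmem⟩⟩
      have hle := activeDeg_le (isSchedule h0 h1 D) (weight_zero_mul_le h0 hdeg β)
        (show k ≤ lastStep ε D by omega) (activeSet_antitone hks hu') hacc
      refine (activeDeg_antitone u hks).trans (hle.trans ?_)
      push Not at hk
      rw [weight, div_div_cancel₀ (by norm_num)]
      have h8 : 8 * (lastStep ε D - k) = 4 * (lastStep ε D - k) * 2 := by ring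
      rw [h8, pow_mul]
      exact pow_le_pow_left₀ (growth_pow_pos h0 _).le hk.le 2
    have hcard : ((coverBad G ε D β s).card : ℝ)
        ≤ 2 * C.card / growth ε ^ (9 * (lastStep ε D - s)) := by
      by_contra hcon
      exact hu ⟨hsum, hd, not_le.1 hcon⟩
    rw [div_le_iff₀ (weight_pos h0 s)]
    refine hcard.trans (le_of_eq ?_)
    rw [weight, mul_comm 9, mul_comm 8, pow_mul, pow_mul]
    field_simp

theorem coverBad_eq_empty {j : ℕ → ℕ} (hj : j = sampleExp ε D) {ω : Coins V} {s : ℕ}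
    (hs : exactStep ε D ≤ s) : coverBad G ε D (sampleBits j ω) s = ∅ := by
  rw [coverBad, Finset.eq_empty_iff_forall_notMem]
  intro v hv
  have hdev := (mem_badSet.1 hv).2.2
  have hj0 : sampleExp ε D s = 0 := sampleExp_eq_zero hs
  have heq : sampledDeg G (scaledIncrement ε D) (sampleBits j ω) s v
      = activeDeg G (scaledIncrement ε D) (sampleBits j ω) s v := by
    unfold sampledDeg activeDeg sampledCount nbrCount
    congr 3
    ext u
    simp [sampleBits, sampleBit, hj, hj0]
  rw [Deviates, heq, tolerance, if_neg (by omega), scaledIncrement, hj0] at hdev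
  simp at hdev

theorem sum_coverBad_le (h0 : 0 < ε) (h1 : ε ≤ 1 / 1000)
    (hdeg : ∀ v, nbrCount G Finset.univ v ≤ D) {C : Finset V} {ℓ : ℝ} {ω : Coins V}
    (h : ∀ s < exactStep ε D, ¬ UnusualStep G C ε D ℓ s (sampleBits (sampleExp ε D) ω)) :
    ∑ s ∈ Finset.range (lastStep ε D + 1),
      ((coverBad G ε D (sampleBits (sampleExp ε D) ω) s).card : ℝ) / weight ε D s
      ≤ ε * C.card := by
  have hRT := exactStep_le (ε := ε) (D := D)
  rw [← Finset.sum_subset (Finset.range_mono (show exactStep ε D ≤ lastStep ε D + 1 by omega))]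
  · refine (Finset.sum_le_sum fun s hs =>
      card_coverBad_div_le h0 h1 hdeg h (Finset.mem_range.1 hs)).trans ?_
    rw [← Finset.mul_sum, mul_comm]
    exact mul_le_mul_of_nonneg_right (sum_inv_growth_pow_le_eps h0) (Nat.cast_nonneg _)
  · intro s _ hs
    rw [coverBad_eq_empty rfl (by simpa using hs)]
    simp

theorem exp_neg_mul_log {n : ℕ} (hn : 0 < n) (k : ℕ) :
    Real.exp (-(k * Real.log n)) = 1 / (n : ℝ) ^ k := by
  rw [Real.exp_neg, ← Real.log_pow, Real.exp_log (by positivity), one_div]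

theorem eight_mul_pow_le_exp {z : ℝ} (hz : 8000000 ≤ z) :
    8 * z ^ 17 ≤ Real.exp (z ^ 4 / 16) := by
  have h1 := Real.pow_div_factorial_le_exp (z ^ 4 / 16) (by positivity) 6
  refine le_trans ?_ h1
  have h2 : (0 : ℝ) < z := by linarith
  have h3 : (8000000 : ℝ) ^ 7 ≤ z ^ 7 := pow_le_pow_left₀ (by norm_num) hz 7
  have h4 : (z ^ 4 / 16) ^ 6 / (Nat.factorial 6 : ℝ) = z ^ 17 * (z ^ 7 / (16 ^ 6 * 720)) := by
    norm_num [Nat.factorial]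
    ring
  rw [h4, mul_comm]
  refine mul_le_mul_of_nonneg_left ?_ (by positivity)
  rw [le_div_iff₀ (by norm_num)]
  linarith

theorem large_le_growth_pow (h0 : 0 < ε) (h1 : ε ≤ 1 / 1000) {s : ℕ} (hs : s < exactStep ε D) :
    8000000 ≤ growth ε ^ (lastStep ε D - s) := by
  refine (large_le_growth_pow_exactLen h0 h1).trans (pow_le_pow_right₀ (one_le_growth h0) ?_)
  have := lastStep_sub (ε := ε) (D := D) (by omega)
  omega

theorem listAvg_unusualStep_le (h0 : 0 < ε) (h1 : ε ≤ 1 / 1000)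
    (hdeg : ∀ v, nbrCount G Finset.univ v ≤ D)
    {C : Finset V} (hC : ∀ u v, G.Adj u v → u ∈ C ∨ v ∈ C)
    (hlog : 1 ≤ Real.log (Fintype.card V))
    (hbig : 2 ^ 84 * Real.log (Fintype.card V) ^ 12 ≤ C.card)
    {s : ℕ} (hs : s < exactStep ε D) (β : ℕ × V → Bool) :
    listAvg (bitProb (sampleExp ε D)) (stepList V s)
      (fun β => if UnusualStep G C ε D (128 * Real.log (Fintype.card V)) s β then 1 else 0) β
      ≤ 2 / (Fintype.card V : ℝ) ^ 7 := by
  have hn : 0 < Fintype.card V := by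
    by_contra hcon
    have : Fintype.card V = 0 := by omega
    rw [this] at hlog
    norm_num at hlog
  have hsT : s ≤ lastStep ε D := by
    have := exactStep_le (ε := ε) (D := D)
    omega
  set n := Fintype.card V with hn_def
  set lg := Real.log n with hlg
  set z := growth ε ^ (lastStep ε D - s) with hz_def
  have hz : 8000000 ≤ z := large_le_growth_pow h0 h1 hs
  have hz0 : 0 < z := by linarith
  have hpow : ∀ k, growth ε ^ (k * (lastStep ε D - s)) = z ^ k := fun k => by
    rw [mul_comm, pow_mul]
  have hw : weight ε D s = 2 / z ^ 8 := by rw [weight, hpow]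
  have hη : tolerance ε D s = 1 / z := by rw [tolerance, if_pos hs]
  have hS : 0 < 4 / z ^ 6 := by positivity
  have hgS : 2 / weight ε D s * scaledIncrement ε D s ^ 2 ≤ 4 / z ^ 6 := by
    have := scaledIncrement_le (D := D) h0 s
    rwa [hpow] at this
  have hexp : tolerance ε D s ^ 2 / (4 * (4 / z ^ 6)) = z ^ 4 / 16 := by
    rw [hη]
    field_simp
    norm_num
  have hsched := isSchedule h0 h1 D
  have hx0 := weight_zero_mul_le (G := G) h0 hdeg
  unfold UnusualStep
  simp only [hpow]
  by_cases hl : 128 * lg ≤ z ^ 4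
  · simp only [if_pos hl]
    have key := listAvg_badSet_nonempty_le (j := sampleExp ε D) hsched (hx0 β) hsT
      (scaledIncrement_mul s) hS hgS
    refine le_trans (le_of_eq (congrFun (congrArg _ (funext fun β => ?_)) β)) (key.trans ?_)
    · exact if_congr Iff.rfl rfl rfl
    rw [hexp]
    have h2 : Real.exp (-(z ^ 4 / 16)) ≤ 1 / (n : ℝ) ^ 8 := by
      rw [← exp_neg_mul_log hn]
      refine Real.exp_le_exp.2 ?_
      push_cast
      linarith
    refine (mul_le_mul_of_nonneg_left (mul_le_mul_of_nonneg_left h2 zero_le_two)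
      (Nat.cast_nonneg _)).trans (le_of_eq ?_)
    have : (n : ℝ) ≠ 0 := by positivity
    rw [← hn_def]
    field_simp
  · simp only [if_neg hl]
    push Not at hl
    have hCpos : (0 : ℝ) < C.card := lt_of_lt_of_le (by positivity) hbig
    have hS' : 0 < 4 * (128 * lg) ^ 2 * z ^ 16 * C.card := by positivity
    have ht : 0 ≤ (C.card : ℝ) / z ^ 9 := by positivity
    have key := listAvg_card_badSet_gt_le (β := β) (j := sampleExp ε D) hsched hx0 hC hsT
      (scaledIncrement_mul s) hS hgS (q := (128 * lg) ^ 2) (by positivity) hS'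
      (le_of_eq (by rw [hw]; field_simp; norm_num)) ht
    have hmean : 8 * C.card / weight ε D s
        * (2 * Real.exp (-(tolerance ε D s ^ 2 / (4 * (4 / z ^ 6))))) + C.card / z ^ 9
        ≤ 2 * C.card / z ^ 9 := by
      have h2 : 8 * z ^ 8 * Real.exp (-(z ^ 4 / 16)) ≤ 1 / z ^ 9 := by
        rw [Real.exp_neg, ← div_eq_mul_inv, div_le_div_iff₀ (Real.exp_pos _) (by positivity)]
        refine le_trans (le_of_eq ?_) ((eight_mul_pow_le_exp hz).trans (le_of_eq (one_mul _).symm))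
        ring
      have h3 := mul_le_mul_of_nonneg_left h2 hCpos.le
      rw [hexp, hw]
      have h4 : 8 * (C.card : ℝ) / (2 / z ^ 8) * (2 * Real.exp (-(z ^ 4 / 16)))
          = C.card * (8 * z ^ 8 * Real.exp (-(z ^ 4 / 16))) := by field_simp
      have h5 : 2 * (C.card : ℝ) / z ^ 9 = C.card * (1 / z ^ 9) + C.card / z ^ 9 := by ring
      rw [h4, h5]
      linarith
    have htail : Real.exp (-(((C.card : ℝ) / z ^ 9) ^ 2
        / (4 * (4 * (128 * lg) ^ 2 * z ^ 16 * C.card)))) ≤ 2 / (n : ℝ) ^ 7 := by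
      have h2 : ((C.card : ℝ) / z ^ 9) ^ 2 / (4 * (4 * (128 * lg) ^ 2 * z ^ 16 * C.card))
          = C.card / (16 * (128 * lg) ^ 2 * z ^ 34) := by field_simp; norm_num
      have h3 : z ^ 34 ≤ (128 * lg) ^ 9 := by
        calc z ^ 34 ≤ z ^ 36 := pow_le_pow_right₀ (by linarith) (by norm_num)
          _ = (z ^ 4) ^ 9 := by ring
          _ ≤ _ := pow_le_pow_left₀ (by positivity) hl.le 9
      have h4 : 7 * lg ≤ C.card / (16 * (128 * lg) ^ 2 * z ^ 34) := by
        rw [le_div_iff₀ (by positivity)]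
        calc 7 * lg * (16 * (128 * lg) ^ 2 * z ^ 34)
            ≤ 7 * lg * (16 * (128 * lg) ^ 2 * (128 * lg) ^ 9) := by gcongr
          _ = 7 * 16 * 128 ^ 11 * lg ^ 12 := by ring
          _ ≤ 2 ^ 84 * lg ^ 12 := by
              refine mul_le_mul_of_nonneg_right (by norm_num) (by positivity)
          _ ≤ C.card := hbig
      rw [h2]
      calc _ ≤ Real.exp (-((7 : ℕ) * lg)) := Real.exp_le_exp.2 (by push_cast; linarith)
        _ = 1 / (n : ℝ) ^ 7 := exp_neg_mul_log hn 7
        _ ≤ 2 / (n : ℝ) ^ 7 := by gcongr; norm_num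
    refine le_trans (listAvg_mono (fun i => bitProb_mem _ i) _ (fun β => ?_) β)
      (key.trans htail)
    by_cases hE : (∑ k ∈ Finset.range s, ((coverBad G ε D β k).card : ℝ) / weight ε D k ≤ C.card) ∧
        (∀ u ∈ activeSet G (scaledIncrement ε D) β s,
          activeDeg G (scaledIncrement ε D) β s u ≤ (128 * lg) ^ 2) ∧
        2 * C.card / z ^ 9 < (coverBad G ε D β s).card
    · rw [if_pos hE, if_pos ⟨hE.1, hE.2.1, hmean.trans_lt hE.2.2⟩]
    · rw [if_neg hE]
      split_ifs <;> norm_num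

/-! ### The number of awake rounds -/

theorem sum_mul_half_pow_le {m : ℕ} (hm : 0 < m) (L : ℕ) :
    ∑ k ∈ Finset.range (m * L), (k : ℝ) * (1 / 2) ^ (k / m)
      ≤ m ^ 2 * (4 - (2 * L + 4) * (1 / 2) ^ L) := by
  induction L with
  | zero => simp
  | succ L ih =>
    rw [Nat.mul_succ, Finset.sum_range_add]
    have h1 : ∑ i ∈ Finset.range m, ((m * L + i : ℕ) : ℝ) * (1 / 2) ^ ((m * L + i) / m)
        ≤ m * (m * (L + 1) * (1 / 2) ^ L) := by
      refine (Finset.sum_le_card_nsmul _ _ ((m : ℝ) * (L + 1) * (1 / 2) ^ L) fun i hi => ?_).trans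
        (by simp)
      have hi' := Finset.mem_range.1 hi
      rw [Nat.mul_add_div hm, Nat.div_eq_of_lt hi', add_zero]
      refine mul_le_mul_of_nonneg_right ?_ (by positivity)
      have : m * L + i ≤ m * (L + 1) := by rw [Nat.mul_succ]; omega
      exact_mod_cast this
    refine (add_le_add ih h1).trans (le_of_eq ?_)
    push_cast
    rw [pow_succ]
    ring

theorem sum_wake_mean_le (h0 : 0 < ε) :
    ∑ s ∈ Finset.range (exactStep ε D), ((exactStep ε D - s : ℕ) : ℝ) * (1 / 2) ^ sampleExp ε D s
      ≤ 4 * (phaseLen ε : ℝ) ^ 2 := by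
  set R := exactStep ε D
  set m := phaseLen ε
  have hm : 0 < m := phaseLen_pos h0
  have hle : ∑ s ∈ Finset.range R, ((R - s : ℕ) : ℝ) * (1 / 2) ^ sampleExp ε D s
      ≤ ∑ k ∈ Finset.range (m * (R + 1)), (k : ℝ) * (1 / 2) ^ (k / m) := by
    rw [← Finset.sum_range_reflect]
    calc _ = ∑ k ∈ Finset.range R, ((k + 1 : ℕ) : ℝ) * (1 / 2) ^ ((k + 1) / m) := by
          refine Finset.sum_congr rfl fun k hk => ?_
          have hk' := Finset.mem_range.1 hk
          have : R - (R - 1 - k) = k + 1 := by omega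
          rw [sampleExp, this]
      _ ≤ ∑ k ∈ Finset.range (R + 1), (k : ℝ) * (1 / 2) ^ (k / m) := by
          rw [Finset.sum_range_succ']
          simp
      _ ≤ _ := Finset.sum_le_sum_of_subset_of_nonneg
          (Finset.range_mono (Nat.le_mul_of_pos_left _ hm)) fun k _ _ => by positivity
  refine hle.trans ((sum_mul_half_pow_le hm _).trans ?_)
  have : (0 : ℝ) ≤ (2 * ((R + 1 : ℕ) : ℝ) + 4) * (1 / 2) ^ (R + 1) := by positivity
  have hm2 : (0 : ℝ) ≤ (m : ℝ) ^ 2 := sq_nonneg _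
  nlinarith

/-- The pairs of a node and a step in which sampling takes place. -/
noncomputable def sampleIndex (V : Type*) [Fintype V] (R : ℕ) : Finset (ℕ × V) :=
  Finset.range R ×ˢ Finset.univ

/-- A bound for the total number of steps for which the nodes are awake before step `R`. -/
noncomputable def earlyAwake (R : ℕ) (β : ℕ × V → Bool) : ℝ :=
  ∑ i ∈ sampleIndex V R, ((R - i.1 : ℕ) : ℝ) * if β i then 1 else 0

theorem listAvg_earlyAwake_le (h0 : 0 < ε) (hn : 0 < Fintype.card V) {q : ℝ} (hq : 0 < q)
    (hR : (exactStep ε D : ℝ) ≤ q)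
    (hbig : 28 * Real.log (Fintype.card V) * q ^ 3 ≤ Fintype.card V) (β : ℕ × V → Bool) :
    listAvg (bitProb (sampleExp ε D)) (sampleIndex V (exactStep ε D)).toList
      (fun β => if Fintype.card V * (4 * (phaseLen ε : ℝ) ^ 2 + 1) ≤ earlyAwake (exactStep ε D) β
        then 1 else 0) β ≤ 1 / (Fintype.card V : ℝ) ^ 7 := by
  set n := Fintype.card V with hn_def
  set R := exactStep ε D with hR_def
  have hn' : (0 : ℝ) < n := by positivity
  have hmean : ∑ i ∈ sampleIndex V R, ((R - i.1 : ℕ) : ℝ) * bitProb (sampleExp ε D) i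
      ≤ n * (4 * (phaseLen ε : ℝ) ^ 2) := by
    rw [sampleIndex, Finset.sum_product_right]
    refine (Finset.sum_le_card_nsmul _ _ _ fun v _ => sum_wake_mean_le (D := D) h0).trans ?_
    rw [Finset.card_univ, nsmul_eq_mul]
  have hsq : ∑ i ∈ sampleIndex V R, ((R - i.1 : ℕ) : ℝ) ^ 2 ≤ n * q ^ 3 := by
    have hb : ∀ i ∈ sampleIndex V R, ((R - i.1 : ℕ) : ℝ) ^ 2 ≤ q ^ 2 := fun i _ =>
      pow_le_pow_left₀ (Nat.cast_nonneg _) ((Nat.cast_le.2 (Nat.sub_le _ _)).trans hR) 2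
    refine (Finset.sum_le_card_nsmul _ _ _ hb).trans ?_
    rw [nsmul_eq_mul, sampleIndex, Finset.card_product, Finset.card_range, Finset.card_univ,
      Nat.cast_mul]
    have : (R : ℝ) * n * q ^ 2 ≤ q * n * q ^ 2 := by gcongr
    refine this.trans (le_of_eq (by ring))
  have key := linear_upper_tail (p := bitProb (sampleExp ε D)) (fun i => bitProb_mem _ i)
    (sampleIndex V R) (fun i => ((R - i.1 : ℕ) : ℝ)) (S := n * q ^ 3) (t := n) (by positivity)
    hn'.le hsq β
    (E := fun β => if n * (4 * (phaseLen ε : ℝ) ^ 2 + 1) ≤ earlyAwake R β then 1 else 0)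
    (fun β => by split_ifs <;> norm_num)
    (fun β hβ => by
      rw [if_neg]
      rw [not_le]
      refine lt_of_lt_of_le hβ ?_
      linarith)
  refine key.trans ?_
  rw [← exp_neg_mul_log hn]
  refine Real.exp_le_exp.2 (neg_le_neg ?_)
  rw [le_div_iff₀ (by positivity)]
  push_cast
  calc 7 * Real.log n * (4 * (n * q ^ 3)) = (n : ℝ) * (28 * Real.log n * q ^ 3) := by ring
    _ ≤ (n : ℝ) * n := mul_le_mul_of_nonneg_left hbig hn'.le
    _ = (n : ℝ) ^ 2 := (sq _).symm

theorem sum_awake_le (ω : Coins V) :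
    ∑ v : V, ((lastStep ε D + 3 - coverAlgorithm.wake (sampleExp ε D) ω v : ℕ) : ℝ)
      ≤ Fintype.card V * (exactLen ε + 3)
        + earlyAwake (exactStep ε D) (sampleBits (sampleExp ε D) ω) := by
  set R := exactStep ε D with hR_def
  set T := lastStep ε D with hT_def
  have hTR : T ≤ R + exactLen ε := by
    rw [hR_def, hT_def]
    unfold exactStep
    omega
  have hRT : R ≤ T := exactStep_le
  rw [earlyAwake, sampleIndex, Finset.sum_product_right, ← nsmul_eq_mul, ← Finset.card_univ,
    ← Finset.sum_const, ← Finset.sum_add_distrib]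
  refine Finset.sum_le_sum fun v _ => ?_
  set w := coverAlgorithm.wake (sampleExp ε D) ω v with hw
  have hnn : ∀ s ∈ Finset.range R, (0 : ℝ) ≤ ((R - s : ℕ) : ℝ)
      * if sampleBits (sampleExp ε D) ω (s, v) then 1 else 0 := fun s _ => by
    split_ifs <;> positivity
  have hmem : sampleBits (sampleExp ε D) ω (w, v) = true :=
    Nat.sInf_mem (s := {s | sampleBit (sampleExp ε D) (fun k => ω (v, k)) s = true})
      ⟨T, by simp [sampleBit, sampleExp_eq_zero hRT]⟩
  by_cases h : w < R
  · have h1 := Finset.single_le_sum hnn (Finset.mem_range.2 h)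
    rw [if_pos hmem, mul_one] at h1
    have h2 : T + 3 - w ≤ exactLen ε + 3 + (R - w) := by omega
    have h3 : ((T + 3 - w : ℕ) : ℝ) ≤ exactLen ε + 3 + ((R - w : ℕ) : ℝ) := by exact_mod_cast h2
    exact h3.trans (add_le_add le_rfl h1)
  · have h2 : T + 3 - w ≤ exactLen ε + 3 := by omega
    have h3 : ((T + 3 - w : ℕ) : ℝ) ≤ exactLen ε + 3 := by exact_mod_cast h2
    exact h3.trans (le_add_of_nonneg_right (Finset.sum_nonneg hnn))

theorem awake_budget_le (h0 : 0 < ε) (h1 : ε ≤ 1 / 1000) :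
    (exactLen ε : ℝ) + 3 + (4 * (phaseLen ε : ℝ) ^ 2 + 1) ≤ 100 / ε ^ 3 := by
  have h2 : (exactLen ε : ℝ) ≤ 64 / ε ^ 3 + 1 := (Nat.ceil_lt_add_one (by positivity)).le
  have h3 : (phaseLen ε : ℝ) ≤ 8 / ε + 1 := (Nat.ceil_lt_add_one (by positivity)).le
  have hε : ε ^ 3 ≤ (1 / 1000) ^ 3 := pow_le_pow_left₀ h0.le h1 3
  have h4 : 1 ≤ 1 / ε := by rw [le_div_iff₀ h0]; linarith
  have h5 : (phaseLen ε : ℝ) ^ 2 ≤ (9 / ε) ^ 2 := by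
    refine pow_le_pow_left₀ (Nat.cast_nonneg _) (h3.trans ?_) 2
    have : 9 / ε = 8 / ε + 1 / ε := by ring
    linarith
  have h6 : 4 * (9 / ε) ^ 2 ≤ 1 / ε ^ 3 := by
    rw [div_pow, ← mul_div_assoc, div_le_div_iff₀ (by positivity) (by positivity)]
    have : ε ^ 3 = ε ^ 2 * ε := by ring
    nlinarith [sq_nonneg ε]
  have h7 : 5 ≤ 1 / ε ^ 3 := by
    rw [le_div_iff₀ (by positivity)]
    linarith
  have h8 : 100 / ε ^ 3 = 64 / ε ^ 3 + 36 * (1 / ε ^ 3) := by ring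
  linarith

end Probability

section Main

open Classical CoverParams

variable {V : Type*} [Fintype V] {G : SimpleGraph V} {ε : ℝ} {D : ℕ}

theorem three_le_card_of_large {n c : ℕ} (hn : 2 ≤ n)
    (h : 2 ^ 100 * ((c : ℝ) + 1) ^ 6 * Real.log n ^ 18 ≤ n) : 3 ≤ n := by
  by_contra hcon
  have hn2 : n = 2 := by omega
  subst hn2
  have h1 : (0.69 : ℝ) ≤ Real.log (2 : ℕ) := by
    have := Real.log_two_gt_d9
    push_cast
    linarith
  have h2 : (0.69 : ℝ) ^ 18 ≤ Real.log (2 : ℕ) ^ 18 := pow_le_pow_left₀ (by norm_num) h1 18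
  have h3 : (1 : ℝ) ≤ ((c : ℝ) + 1) ^ 6 := one_le_pow₀ (by linarith [Nat.cast_nonneg (α := ℝ) c])
  have h4 : (2 : ℝ) ^ 100 * 1 * 0.69 ^ 18 ≤ 2 ^ 100 * ((c : ℝ) + 1) ^ 6 * Real.log (2 : ℕ) ^ 18 := by
    gcongr
  have h5 := h4.trans h
  norm_num at h5

theorem one_le_log_of_three_le {n : ℕ} (hn : 3 ≤ n) : 1 ≤ Real.log n := by
  rw [Real.le_log_iff_exp_le (by positivity)]
  have h : (3 : ℝ) ≤ n := by exact_mod_cast hn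
  linarith [Real.exp_one_lt_d9]

/-- The probability that some step is unusual or that the nodes are awake for too long. -/
theorem coinMeasure_unusual_le (h0 : 0 < ε) (h1 : ε ≤ 1 / 1000)
    (hdeg : ∀ v, nbrCount G Finset.univ v ≤ D)
    {C : Finset V} (hC : ∀ u v, G.Adj u v → u ∈ C ∨ v ∈ C) {c X : ℕ} (hX : 2 ≤ X)
    (hXn : X ≤ Fintype.card V) (hD : D ≤ X ^ c)
    (hbig : 2 ^ 100 * ((c : ℝ) + 1) ^ 6 * Real.log (Fintype.card V) ^ 18 ≤ C.card) :
    coinMeasure V {ω | (∃ s < exactStep ε D, UnusualStep G C ε D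
        (128 * Real.log (Fintype.card V)) s (sampleBits (sampleExp ε D) ω)) ∨
        Fintype.card V * (4 * (phaseLen ε : ℝ) ^ 2 + 1)
          ≤ earlyAwake (exactStep ε D) (sampleBits (sampleExp ε D) ω)}
      ≤ ENNReal.ofReal (1 / (Fintype.card V : ℝ) ^ 5) := by
  set n := Fintype.card V with hn_def
  set R := exactStep ε D with hR_def
  have hCn : (C.card : ℝ) ≤ n := Nat.cast_le.2 (Finset.card_le_univ C)
  have hn3 : 3 ≤ n := three_le_card_of_large (hX.trans hXn) (hbig.trans hCn)
  have hlog := one_le_log_of_three_le hn3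
  set lg := Real.log n with hlg
  have hc0 : (0 : ℝ) ≤ c := Nat.cast_nonneg c
  have hc1 : (1 : ℝ) ≤ (c : ℝ) + 1 := by linarith
  have hbig' : 2 ^ 84 * lg ^ 12 ≤ C.card := by
    refine le_trans ?_ hbig
    calc 2 ^ 84 * lg ^ 12 = 2 ^ 84 * 1 * lg ^ 12 := by ring
      _ ≤ 2 ^ 100 * ((c : ℝ) + 1) ^ 6 * lg ^ 18 := by
          gcongr
          · norm_num
          · norm_num
          · exact one_le_pow₀ hc1
          · norm_num
  have hXlog : Real.log X ≤ lg :=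
    Real.log_le_log (by positivity) (by exact_mod_cast hXn)
  set q : ℝ := (3 * (c + 1) * lg) ^ 2 with hq_def
  have hq : 0 < q := by positivity
  have hRq : (R : ℝ) ≤ q := by
    rcases Nat.eq_zero_or_pos R with h | h
    · rw [h, Nat.cast_zero]
      exact hq.le
    · refine (Nat.cast_le.2 exactStep_le).trans ((lastStep_le_sq h0 h1 h).trans ?_)
      refine pow_le_pow_left₀ (Nat.cast_nonneg _) ((clog_degree_le hX hD).trans ?_) 2
      exact mul_le_mul_of_nonneg_left hXlog (by positivity)
  have hq3 : 28 * lg * q ^ 3 ≤ n := by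
    refine le_trans ?_ (hbig.trans hCn)
    calc 28 * lg * q ^ 3 = 28 * 729 * ((c : ℝ) + 1) ^ 6 * lg ^ 7 := by rw [hq_def]; ring
      _ ≤ 2 ^ 100 * ((c : ℝ) + 1) ^ 6 * lg ^ 18 := by
          gcongr
          · norm_num
          · norm_num
  have hq1 : 1 ≤ q := by
    rw [hq_def]
    refine one_le_pow₀ ?_
    nlinarith
  have hRn : (R : ℝ) ≤ n := by
    refine hRq.trans (le_trans ?_ hq3)
    have : q ≤ q ^ 3 := le_self_pow₀ hq1 (by norm_num)
    nlinarith
  have hstep : ∀ s ∈ Finset.range R, coinMeasure V {ω | UnusualStep G C ε D (128 * lg) s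
      (sampleBits (sampleExp ε D) ω)} ≤ ENNReal.ofReal (2 / (n : ℝ) ^ 7) := fun s hs =>
    coinMeasure_le_of_listAvg_le (R := R) (fun s hs => sampleExp_eq_zero hs) (stepList V s)
      (UnusualStep G C ε D (128 * lg) s)
      fun β => listAvg_unusualStep_le h0 h1 hdeg hC hlog hbig' (Finset.mem_range.1 hs) β
  have hawake : coinMeasure V {ω | n * (4 * (phaseLen ε : ℝ) ^ 2 + 1)
      ≤ earlyAwake R (sampleBits (sampleExp ε D) ω)} ≤ ENNReal.ofReal (1 / (n : ℝ) ^ 7) :=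
    coinMeasure_le_of_listAvg_le (R := R) (fun s hs => sampleExp_eq_zero hs)
      (sampleIndex V R).toList
      (fun β => n * (4 * (phaseLen ε : ℝ) ^ 2 + 1) ≤ earlyAwake R β)
      fun β => (le_of_eq (congrFun (congrArg _ (funext fun β => if_congr Iff.rfl rfl rfl)) β)).trans
        (listAvg_earlyAwake_le h0 (by omega) hq hRq hq3 β)
  have hsub : {ω | (∃ s < R, UnusualStep G C ε D (128 * lg) s (sampleBits (sampleExp ε D) ω)) ∨
      n * (4 * (phaseLen ε : ℝ) ^ 2 + 1) ≤ earlyAwake R (sampleBits (sampleExp ε D) ω)}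
      ⊆ (⋃ s ∈ Finset.range R, {ω | UnusualStep G C ε D (128 * lg) s
          (sampleBits (sampleExp ε D) ω)}) ∪
        {ω : Coins V | n * (4 * (phaseLen ε : ℝ) ^ 2 + 1)
          ≤ earlyAwake R (sampleBits (sampleExp ε D) ω)} := by
    rintro ω (⟨s, hs, h⟩ | h)
    · exact Or.inl (Set.mem_biUnion (Finset.mem_coe.2 (Finset.mem_range.2 hs)) h)
    · exact Or.inr h
  have hnpos : (0 : ℝ) < n := by positivity
  refine (measure_mono hsub).trans ((measure_union_le _ _).trans ?_)
  refine (add_le_add ((measure_biUnion_finset_le _ _).trans (Finset.sum_le_sum hstep))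
    hawake).trans ?_
  rw [Finset.sum_const, Finset.card_range, nsmul_eq_mul, ← ENNReal.ofReal_natCast,
    ← ENNReal.ofReal_mul (Nat.cast_nonneg _), ← ENNReal.ofReal_add (by positivity) (by positivity)]
  refine ENNReal.ofReal_le_ofReal ?_
  have h3 : (3 : ℝ) ≤ n := by exact_mod_cast hn3
  calc (R : ℝ) * (2 / (n : ℝ) ^ 7) + 1 / (n : ℝ) ^ 7
      ≤ n * (2 / (n : ℝ) ^ 7) + 1 / (n : ℝ) ^ 7 := by gcongr
    _ = (2 * n + 1) / (n : ℝ) ^ 7 := by ring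
    _ ≤ (n : ℝ) ^ 2 / (n : ℝ) ^ 7 := by
        gcongr
        nlinarith
    _ = 1 / (n : ℝ) ^ 5 := by field_simp

variable [DecidableRel G.Adj] {P : PortNumbering G}

theorem nodeAveragedAwakeComplexity_le [Nonempty V] (h0 : 0 < ε) (h1 : ε ≤ 1 / 1000) {ω : Coins V}
    (h : earlyAwake (exactStep ε D) (sampleBits (sampleExp ε D) ω)
      ≤ Fintype.card V * (4 * (phaseLen ε : ℝ) ^ 2 + 1)) :
    (coverAlgorithm (lastStep ε D) (sampleExp ε D)
      (scaledIncrement ε D)).nodeAveragedAwakeComplexity P ω ≤ ENNReal.ofReal (100 / ε ^ 3) := by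
  have hn : (0 : ℝ) < Fintype.card V := by exact_mod_cast Fintype.card_pos
  have hT : sampleExp ε D (lastStep ε D) = 0 := sampleExp_eq_zero exactStep_le
  unfold SleepingAlgorithm.nodeAveragedAwakeComplexity
  refine ENNReal.div_le_of_le_mul ?_
  have hv : ∀ v ∈ (Finset.univ : Finset V), (((coverAlgorithm (lastStep ε D) (sampleExp ε D)
      (scaledIncrement ε D)).awakeComplexity P ω v : ℕ∞) : ℝ≥0∞)
      ≤ ENNReal.ofReal ((lastStep ε D + 3 - coverAlgorithm.wake (sampleExp ε D) ω v : ℕ) : ℝ) :=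
    fun v _ => by
      rw [ENNReal.ofReal_natCast]
      exact_mod_cast coverAlgorithm.awakeComplexity_le (P := P) (g := scaledIncrement ε D)
        (ω := ω) hT v
  refine (Finset.sum_le_sum hv).trans ?_
  rw [← ENNReal.ofReal_sum_of_nonneg fun v _ => Nat.cast_nonneg _, ← ENNReal.ofReal_natCast,
    ← ENNReal.ofReal_mul (by positivity)]
  refine ENNReal.ofReal_le_ofReal ((sum_awake_le ω).trans ?_)
  have := mul_le_mul_of_nonneg_left (awake_budget_le h0 h1) hn.le
  linarith

theorem nbrCount_univ_le (hD : G.maxDegree ≤ D) (v : V) : nbrCount G Finset.univ v ≤ D := by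
  refine le_trans ?_ ((G.degree_le_maxDegree v).trans hD)
  rw [← G.card_neighborFinset_eq_degree]
  refine Finset.card_le_card fun u hu => ?_
  simpa [nbrCount] using hu

theorem card_outputSet_le (h0 : 0 < ε) (h1 : ε ≤ 1 / 1000)
    (hdeg : ∀ v, nbrCount G Finset.univ v ≤ D) {C : Finset V}
    (hC : ∀ u v, G.Adj u v → u ∈ C ∨ v ∈ C) {ℓ : ℝ} {ω : Coins V}
    (h : ∀ s < exactStep ε D, ¬ UnusualStep G C ε D ℓ s (sampleBits (sampleExp ε D) ω)) :
    (((coverAlgorithm (lastStep ε D) (sampleExp ε D) (scaledIncrement ε D)).outputSet P ω).ncard : ℝ)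
      ≤ (2 + 100 * ε) * C.card := by
  rw [coverAlgorithm.outputSet_eq (sampleExp_eq_zero exactStep_le), Set.ncard_coe_finset]
  exact card_compl_activeSet_le (isSchedule h0 h1 D) (weight_zero_mul_le h0 hdeg _) hC
    (sum_coverBad_le h0 h1 hdeg h)

theorem lastStep_add_two_le {c X : ℕ} (hX : 2 ≤ X) (hD : D ≤ X ^ c) :
    (lastStep ε D : ℝ) + 2 ≤ (⌈1 / ε⌉₊ * (3 * (c + 1)) + 4) * Real.log X := by
  have h1 := mul_le_mul_of_nonneg_left (clog_degree_le hX hD) (Nat.cast_nonneg (α := ℝ) ⌈1 / ε⌉₊)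
  have h2 : (lastStep ε D : ℝ) = ⌈1 / ε⌉₊ * (Nat.clog 2 (2 * D) : ℝ) := by
    rw [lastStep, Nat.cast_mul]
  have h3 : Real.log 2 ≤ Real.log X := Real.log_le_log (by norm_num) (by exact_mod_cast hX)
  have h4 := Real.log_two_gt_d9
  rw [h2]
  linarith

end Main

theorem mainTheorem6 (c : ℕ) :
    ∃ κ K : ℝ, 0 < κ ∧ 0 < K ∧
      ∀ ε : ℝ, 0 < ε → ε ≤ 1 / 1000 →
        ∃ (L B : ℝ) (A : ℕ → ℕ → SleepingAlgorithm), 0 < L ∧ 0 < B ∧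
          ∀ (V : Type*) [Fintype V] [Nonempty V] (G : SimpleGraph V) [DecidableRel G.Adj]
            (P : PortNumbering G) (N D : ℕ),
            Fintype.card V ≤ N → N ≤ Fintype.card V ^ c →
            G.maxDegree ≤ D → D ≤ (max G.maxDegree 2) ^ c →
            κ * Real.log (Fintype.card V) ^ 18 ≤ (G.vertexCoverNum.toNat : ℝ) →
            -- for every outcome of the coin flips: round complexity, message size, validity
            (∀ ω : Coins V,
              (∃ T : ℕ, (T : ℝ) ≤ L * Real.log ((max G.maxDegree 2 : ℕ) : ℝ) ∧
                ∀ v, (A N D).HasHalted P ω T v) ∧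
              (A N D).MessageBitsLE P ω (B * Real.log (Fintype.card V)) ∧
              G.IsVertexCover ((A N D).outputSet P ω)) ∧
            -- with probability at least `1 - n⁻⁵`: approximation and awake complexity
            coinMeasure V {ω | ¬ (
                (((A N D).outputSet P ω).ncard : ℝ)
                    ≤ (2 + 100 * ε) * (G.vertexCoverNum.toNat : ℝ) ∧
                (A N D).nodeAveragedAwakeComplexity P ω ≤ ENNReal.ofReal (K / ε ^ 3))}
              ≤ ENNReal.ofReal (1 / (Fintype.card V : ℝ) ^ 5) := by

  classical
  refine ⟨2 ^ 100 * ((c : ℝ) + 1) ^ 6, 100, by positivity, by norm_num, fun ε h0 h1 => ?_⟩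
  refine ⟨⌈1 / ε⌉₊ * (3 * (c + 1)) + 4, ⌈1 / ε⌉₊ * (3 * (c + 1)) + 4, fun _ D =>
    coverAlgorithm (CoverParams.lastStep ε D) (CoverParams.sampleExp ε D)
      (CoverParams.scaledIncrement ε D), by positivity, by positivity, ?_⟩
  intro V _ _ G _ P N D hN hNc hΔD hD hbig
  have hT : CoverParams.sampleExp ε D (CoverParams.lastStep ε D) = 0 :=
    CoverParams.sampleExp_eq_zero CoverParams.exactStep_le
  have hX : 2 ≤ max G.maxDegree 2 := le_max_right _ _
  have hrounds := lastStep_add_two_le (ε := ε) hX hD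
  have hXn : 2 ≤ Fintype.card V → max G.maxDegree 2 ≤ Fintype.card V := fun h =>
    max_le G.maxDegree_lt_card_verts.le h
  refine ⟨fun ω => ⟨⟨CoverParams.lastStep ε D + 2, by exact_mod_cast hrounds, fun v =>
    coverAlgorithm.hasHalted hT v⟩, coverAlgorithm.messageBitsLE hT fun v hv => ?_,
    coverAlgorithm.isVertexCover_outputSet (fun s hs => CoverParams.sampleExp_eq_zero hs)
      CoverParams.exactStep_le (CoverParams.scaledIncrement_nonneg h0)
      (CoverParams.one_le_sum_scaledIncrement h0 h1)⟩, ?_⟩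
  · have hn : 2 ≤ Fintype.card V := by
      have := G.degree_lt_card_verts v
      omega
    have hlog : Real.log ((max G.maxDegree 2 : ℕ) : ℝ) ≤ Real.log (Fintype.card V) :=
      Real.log_le_log (by positivity) (by exact_mod_cast hXn hn)
    have := mul_le_mul_of_nonneg_left hlog
      (show (0 : ℝ) ≤ ⌈1 / ε⌉₊ * (3 * (c + 1)) + 4 by positivity)
    linarith
  · rcases Nat.lt_or_ge (Fintype.card V) 2 with hn | hn
    · have hn1 : Fintype.card V = 1 := by
        have := Fintype.card_pos (α := V)
        omega
      rw [hn1]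
      simpa using prob_le_one
    obtain ⟨S, hScard, hScover⟩ := G.vertexCoverNum_exists
    have hC : ∀ u v, G.Adj u v → u ∈ S.toFinset ∨ v ∈ S.toFinset := fun u v h => by
      simpa using hScover h
    have hcard : G.vertexCoverNum.toNat = S.toFinset.card := by
      rw [← hScard, Set.encard_eq_coe_toFinset_card, ENat.toNat_natCast]
    rw [hcard] at hbig ⊢
    have hdeg := nbrCount_univ_le hΔD
    refine le_trans (measure_mono fun ω hω => ?_)
      (coinMeasure_unusual_le h0 h1 hdeg hC hX (hXn hn) hD hbig)
    by_contra hcon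
    rw [Set.mem_ofPred_eq] at hcon
    push Not at hcon
    exact hω ⟨card_outputSet_le h0 h1 hdeg hC hcon.1,
      nodeAveragedAwakeComplexity_le h0 h1 hcon.2.le⟩
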